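/- Let $L,r>0$. A \emph{closed curve} is a map $c:[0,L]\to\mathbb{E}^3$ of class $C^3$ with $c'\neq 0$ everywhere, $c(0)=c(L)$ and $\boldsymbol t(0)=\boldsymbol t(L)$, where $\boldsymbol t$ is the unit tangent (one-sided derivatives at the end points; the parameter need not be arc length). Let $\kappa$ be its curvature and $(\boldsymbol t,\boldsymbol n,\boldsymbol b)$ its Serret--Frenet frame, with $\boldsymbol n$ any unit vector orthogonal to $\boldsymbol t$ where $\kappa=0$. The closed tube $T_r[c]$ is parametrized by $$p(\rho,s,\theta)=c(s)+\rho\cos\theta\,\boldsymbol n(s)+\rho\sin\theta\,\boldsymbol b(s),\qquad \rho\in[0,r],\ s\in[0,L],\ \theta\in[0,2\pi].$$ Two triples are identified if they belong to the same cross-section ($s=0$ and $s=L$ being the same cross-section) and have the same position $p(\rho,s,\theta)-c(s)$ in it. The tube $T_r[c]$ has \emph{self-contact} (on $\operatorname{bd}T_r[c]$) if $p(x)=p(y)$ for two non-identified triples $x,y$ both with $\rho=r$; it has \emph{interpenetration of matter} if $p(x)=p(y)$ for two non-identified triples $x,y$, at least one of which has $\rho<r$. A closed curve is a knot if it is injective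 on $[0,L)$. Two knots $K_0,K_1$ are \emph{ambient isotopic} if there is a continuous $G:\mathbb{E}^3\times[0,1]\to\mathbb{E}^3$ such that every $G(\cdot,t)$ is a homeomorphism, $G(\cdot,0)=\mathrm{Id}$ and $G(K_0(s),1)=K_1(s)$ for all $s$ (every $G(\cdot,t)$ is then orientation-preserving). \textbf{Theorem.} Let $\gamma:[0,L]\to\mathbb{E}^3$ be a closed curve and $H:\mathbb{E}^3\times[0,1]\to\mathbb{E}^3$ a continuous map (the maps $H(\cdot,t)$ need not be homeomorphisms), and write $\gamma_t(s)=H(\gamma(s),t)$. Suppose that (i) for every $t\in[0,1]$, $\gamma_t$ is a closed curve with $r\kappa_{\gamma_t}(s)<1$ for all $s\in[0,L]$ (no singularities and no local interpenetration of matter); (ii) $\gamma_0$ and $\gamma_1$ are knots which are not ambient isotopic; (iii) the initial tube $T_r[\gamma_0]$ has no self-contact. Then there is $t^*\in(0,1)$ such that $T_r[\gamma_{t^*}]$ has self-contact, while $T_r[\gamma_t]$ has no self-contact for any $t<t^*$. Furthermore, there is $\tau\in(t^*,1)$ such that $T_r[\gamma_\tau]$ has interpenetration of matter, and $T_r[\gamma_t]$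 has no interpenetration of matter for any $t<t^*$. -/

import Mathlib

open Set
open scoped unitInterval

/-- Euclidean three-space. -/
abbrev E3 : Type := EuclideanSpace ℝ (Fin 3)

noncomputable section

namespace TubeKnot

/-- The vector product of `E3`. -/
def cross (a b : E3) : E3 := WithLp.toLp 2 (crossProduct a.ofLp b.ofLp)

theorem exists_unit_orthogonal (u : E3) : ∃ v : E3, ‖v‖ = 1 ∧ inner ℝ u v = 0 := by
  obtain ⟨w, hw0, hw⟩ : ∃ w : E3, w ≠ 0 ∧ inner ℝ u w = 0 := by
    by_cases h : u 0 = 0 ∧ u 1 = 0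
    · refine ⟨!₂[1, 0, 0], ?_, ?_⟩
      · intro hz
        have := congrArg (fun x : E3 => x 0) hz
        simp at this
      · simp [PiLp.inner_apply, Fin.sum_univ_three, h.1]
    · refine ⟨!₂[-u 1, u 0, 0], ?_, ?_⟩
      · intro hz
        have h0 := congrArg (fun x : E3 => x 0) hz
        have h1 := congrArg (fun x : E3 => x 1) hz
        simp at h0 h1
        exact h ⟨h1, h0⟩
      · simp [PiLp.inner_apply, Fin.sum_univ_three]
        ring
  exact ⟨‖w‖⁻¹ • w, norm_smul_inv_norm hw0, by rw [inner_smul_right, hw, mul_zero]⟩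

/-! A closed curve is described by a function `c` on the parameter interval `[0, L]`. All
derivatives are derivatives within this interval (one-sided at the end points). The parameter is
any regular one; for a curve parametrized by arc length the speed is `1`. -/

/-- The unit tangent `𝐭(s)`. -/
def tangent (L : ℝ) (c : ℝ → E3) (s : ℝ) : E3 :=
  ‖derivWithin c (Icc 0 L) s‖⁻¹ • derivWithin c (Icc 0 L) s

/-- The curvature vector, that is, the derivative of the unit tangent with respect to
arc length. -/
def curvatureVector (L : ℝ) (c : ℝ → E3) (s : ℝ) : E3 :=
  ‖derivWithin c (Icc 0 L) s‖⁻¹ • derivWithin (tangent L c) (Icc 0 L) s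

/-- The curvature `κ(s)`. -/
def curvature (L : ℝ) (c : ℝ → E3) (s : ℝ) : ℝ := ‖curvatureVector L c s‖

/-- The Serret-Frenet normal `𝐧(s)`. Where the curvature vanishes it is some unit vector
orthogonal to the tangent; the notions of self-contact and interpenetration below do not depend
on which one. -/
def normal (L : ℝ) (c : ℝ → E3) (s : ℝ) : E3 :=
  open Classical in
  if curvatureVector L c s = 0 then (exists_unit_orthogonal (tangent L c s)).choose
  else (curvature L c s)⁻¹ • curvatureVector L c s

/-- The Serret-Frenet binormal `𝐛(s)`. -/
def binormal (L : ℝ) (c : ℝ → E3) (s : ℝ) : E3 := cross (tangent L c s) (normal L c s)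

/-- `c` is, on `[0, L]`, a regular curve of class `C³` that closes up with its tangent. -/
structure IsClosedCurve (L : ℝ) (c : ℝ → E3) : Prop where
  contDiffOn : ContDiffOn ℝ 3 c (Icc 0 L)
  regular : ∀ s ∈ Icc 0 L, derivWithin c (Icc 0 L) s ≠ 0
  closed : c 0 = c L
  tangent_closed : tangent L c 0 = tangent L c L

/-- `c` is a knot: a homeomorphism of the circle `[0, L] / (0 ∼ L)` onto its image. -/
structure IsKnot (L : ℝ) (c : ℝ → E3) : Prop where
  continuousOn : ContinuousOn c (Icc 0 L)
  closed : c 0 = c L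
  injOn : InjOn c (Ico 0 L)

/-- Ambient isotopy of knots. Each `G (·, t)` preserves the orientation, since it is joined to the
identity by a continuous path of homeomorphisms. -/
def AmbientIsotopic (L : ℝ) (K₀ K₁ : ℝ → E3) : Prop :=
  ∃ G : E3 × I → E3, Continuous G ∧ (∀ t : I, IsHomeomorph fun x => G (x, t)) ∧
    (∀ x, G (x, 0) = x) ∧ ∀ s ∈ Icc 0 L, G (K₀ s, 1) = K₁ s

/-- The coordinates `(ρ, s, θ)` of the tube of radius `r`. -/
def coords (L r : ℝ) : Set (ℝ × ℝ × ℝ) := Icc 0 r ×ˢ Icc 0 L ×ˢ Icc 0 (2 * Real.pi)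

/-- The position, relative to the centre `c s`, of the point with coordinates `(ρ, s, θ)` in the
cross-section at `s`. -/
def offset (L : ℝ) (c : ℝ → E3) (x : ℝ × ℝ × ℝ) : E3 :=
  (x.1 * Real.cos x.2.2) • normal L c x.2.1 + (x.1 * Real.sin x.2.2) • binormal L c x.2.1

/-- The map `p (ρ, s, θ) = c(s) + ρ cos θ 𝐧(s) + ρ sin θ 𝐛(s)`. -/
def tubeMap (L : ℝ) (c : ℝ → E3) (x : ℝ × ℝ × ℝ) : E3 := c x.2.1 + offset L c x

/-- Two triples of coordinates denote the same point of the solid torus: they lie in the same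
cross-section (those at `0` and `L` are identified) and at the same place of it. So `θ = 0` and
`θ = 2π` are identified, and so are all `θ` if `ρ = 0`. -/
def SamePoint (L : ℝ) (c : ℝ → E3) (x y : ℝ × ℝ × ℝ) : Prop :=
  (x.2.1 = y.2.1 ∨ (x.2.1 = 0 ∧ y.2.1 = L) ∨ (x.2.1 = L ∧ y.2.1 = 0)) ∧
    offset L c x = offset L c y

/-- Interpenetration of matter: two distinct points of the tube, at least one of them interior
(`ρ < r`), occupy the same place. -/
def HasInterpenetration (L r : ℝ) (c : ℝ → E3) : Prop :=
  ∃ x ∈ coords L r, ∃ y ∈ coords L r,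
    ¬ SamePoint L c x y ∧ tubeMap L c x = tubeMap L c y ∧ (x.1 < r ∨ y.1 < r)

/-- Self-contact: two distinct points of the boundary (`ρ = r`) of the tube occupy the same
place. -/
def HasSelfContact (L r : ℝ) (c : ℝ → E3) : Prop :=
  ∃ x ∈ coords L r, ∃ y ∈ coords L r,
    ¬ SamePoint L c x y ∧ tubeMap L c x = tubeMap L c y ∧ x.1 = r ∧ y.1 = r

/-- The deformed curve `H(γ, t)`. -/
def deform (H : E3 × I → E3) (γ : ℝ → E3) (t : I) (s : ℝ) : E3 := H (γ s, t)

end TubeKnot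

end

namespace TubeKnot

open Filter Topology

/-! The proof works on the circle `AddCircle L`, with normal vectors in place of the angles: the
solid torus consists of pairs of a parameter and a vector of length at most `r` normal to the curve
there. This avoids the Frenet normal, which need not be continuous. Only the curve and its unit
tangent close up, so the periodized curve may have jumps of speed and curvature at the seam; this is
why all estimates use right derivatives.

The bound `r κ < 1` enters through one monotonicity statement, `IsTubeCurve.inner_add_mul_sqrt_le`:
while the tangent stays in the half-space of `e`, the height `⟨c, e⟩` grows faster than the reach `r
√(1 - ⟨T, e⟩²)` of the normal disc in the direction `e` can change. Three consequences follow.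
Nearby normal discs are disjoint. The discs around a given one sweep out a neighbourhood of each of
its points, uniformly in time. A short chord is almost parallel to the tangent; since `H` is merely
continuous, this is what makes the tangents continuous in time (`continuous_tangent_family`).
`IsTubeFamily` records what is needed afterwards.

Any overlap of distinct cross-sections forces contact of boundary with boundary
(`IsTubeFamily.selfContact_of_overlaps`). Without such contact, every partner of a boundary point is
interior, so the boundary points having a partner form a relatively open and closed subset of the
connected boundary torus. It misses the point of the tube farthest from the origin, hence is empty.
Then all partners are interior, and the same argument on the solid torus excludes every overlap.
Thus interpenetration implies self-contact, and by compactness the set of contact times is closed;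
`t*` is its least element.

If every curve of the deformation were embedded, neighbouring curves would be joined by short
bi-Lipschitz straight-line steps, each extending to a homeomorphism of space, and connectedness of
the time interval would make the end knots ambient isotopic (`ambientIsotopic_of_injective`). So
some `γ_{t₁}` passes twice through a point. Its tube interpenetrates itself along the axis, and this
overlap survives at slightly earlier times; hence `t* < t₁ < 1`, and `τ = t₁` serves. -/

/-- A function on `[a, b]` with nonnegative right derivative satisfies `f a ≤ f b`. -/
theorem le_of_rightDeriv_nonneg {f f' : ℝ → ℝ} {a b : ℝ} (hab : a ≤ b) (hf : Continuous f)
    (hd : ∀ x ∈ Ico a b, HasDerivWithinAt f (f' x) (Ici x) x) (h0 : ∀ x ∈ Ico a b, 0 ≤ f' x) :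
    f a ≤ f b := by
  have := image_le_of_deriv_right_le_deriv_boundary (f := fun _ => f a) (f' := fun _ => 0)
    continuousOn_const (fun x _ => hasDerivWithinAt_const _ _ _) le_rfl hf.continuousOn hd
    (by simpa using h0)
  exact this (right_mem_Icc.2 hab)

/-! ### Arcs of curvature less than `1 / r` -/

/-- A curve `c` of period `L` with unit tangent `T`, described by right derivatives: its speed is
at most `V`, and its curvature is smaller than `1 / r`, with a margin `m`. -/
structure IsTubeCurve (L r m V : ℝ) (c T : ℝ → E3) : Prop where
  continuous : Continuous c
  continuous_tangent : Continuous T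
  periodic : Function.Periodic c L
  periodic_tangent : Function.Periodic T L
  norm_tangent : ∀ s, ‖T s‖ = 1
  margin_pos : 0 < m
  exists_deriv : ∀ s, ∃ (v : ℝ) (w : E3), HasDerivWithinAt c (v • T s) (Ici s) s ∧
    HasDerivWithinAt T w (Ici s) s ∧ inner ℝ w (T s) = 0 ∧ v ≤ V ∧ m ≤ v - r * ‖w‖

/-- The component of a unit vector `u` orthogonal to a unit vector `t` has length
`√(1 - ⟨t, u⟩²)`. -/
theorem abs_inner_le_mul_sqrt {t u w : E3} (ht : ‖t‖ = 1) (hu : ‖u‖ = 1) (hw : inner ℝ w t = 0) :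
    |inner ℝ w u| ≤ ‖w‖ * √(1 - inner ℝ t u ^ 2) := by
  have h1 : inner ℝ w u = inner ℝ w (u - inner ℝ t u • t) := by
    rw [inner_sub_right, inner_smul_right, hw]; ring
  have h2 : ‖u - inner ℝ t u • t‖ = √(1 - inner ℝ t u ^ 2) := by
    rw [← Real.sqrt_sq (norm_nonneg (u - _)), norm_sub_sq_real, norm_smul, ht, hu,
      inner_smul_right, real_inner_comm, Real.norm_eq_abs, mul_one, sq_abs]
    congr 1; ring
  rw [h1, ← h2]
  exact abs_real_inner_le_norm _ _

theorem inner_sq_le_one {t u : E3} (ht : ‖t‖ = 1) (hu : ‖u‖ = 1) : inner ℝ t u ^ 2 ≤ 1 := by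
  have := abs_real_inner_le_norm t u
  rw [ht, hu, mul_one] at this
  exact (sq_le_one_iff_abs_le_one _).2 this

namespace IsTubeCurve

variable {L r m V : ℝ} {c T : ℝ → E3}

theorem speed_bound_pos (h : IsTubeCurve L r m V c T) (hr : 0 ≤ r) : 0 < V := by
  obtain ⟨v, w, -, -, -, hv, hm⟩ := h.exists_deriv 0
  nlinarith [h.margin_pos, mul_nonneg hr (norm_nonneg w)]

/-- Both quantities `⟨c, e⟩ ± r √(ε + 1 - ⟨T, e⟩²) - m f₀ u` are nondecreasing as long as
`⟨T, e⟩ ≥ f₀ ≥ 0`. -/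
theorem inner_add_mul_sqrt_le (h : IsTubeCurve L r m V c T) (hr : 0 ≤ r) {e : E3} (he : ‖e‖ = 1)
    {a b f₀ ε q : ℝ} (hab : a ≤ b) (hf₀ : 0 ≤ f₀) (hε : 0 < ε) (hq : |q| = 1)
    (hf : ∀ u ∈ Ico a b, f₀ ≤ inner ℝ (T u) e) :
    inner ℝ (c a) e + q * (r * √(ε + (1 - inner ℝ (T a) e ^ 2))) - m * f₀ * a ≤
      inner ℝ (c b) e + q * (r * √(ε + (1 - inner ℝ (T b) e ^ 2))) - m * f₀ * b := by
  have hcont := h.continuous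
  have hTcont := h.continuous_tangent
  choose v w hc hT hw hV hm using h.exists_deriv
  -- The summand `ε` keeps the square root differentiable where `T = ± e`.
  have hpos : ∀ x, 0 < ε + (1 - inner ℝ (T x) e ^ 2) := fun x => by
    have := inner_sq_le_one (h.norm_tangent x) he; linarith
  refine le_of_rightDeriv_nonneg
    (f := fun x => inner ℝ (c x) e + q * (r * √(ε + (1 - inner ℝ (T x) e ^ 2))) - m * f₀ * x)
    (f' := fun x => v x * inner ℝ (T x) e + q * (r * ((-(2 * inner ℝ (T x) e * inner ℝ (w x) e)) /
      (2 * √(ε + (1 - inner ℝ (T x) e ^ 2))))) - m * f₀) hab (by fun_prop) ?_ ?_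
  · intro x _
    have h1 : HasDerivWithinAt (fun x => inner ℝ (c x) e) (v x * inner ℝ (T x) e) (Ici x) x := by
      have := (hc x).inner ℝ (hasDerivWithinAt_const x (Ici x) e)
      simpa [inner_smul_left] using this
    have h2 : HasDerivWithinAt (fun x => inner ℝ (T x) e) (inner ℝ (w x) e) (Ici x) x := by
      have := (hT x).inner ℝ (hasDerivWithinAt_const x (Ici x) e)
      simpa using this
    have h3 : HasDerivWithinAt (fun x => ε + (1 - inner ℝ (T x) e ^ 2))
        (-(2 * inner ℝ (T x) e * inner ℝ (w x) e)) (Ici x) x := by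
      have := ((h2.pow 2).const_sub 1).const_add ε
      simpa using this
    have h4 := ((h3.sqrt (hpos x).ne').const_mul r).const_mul q
    have h5 : HasDerivWithinAt (fun x => m * f₀ * x) (m * f₀) (Ici x) x := by
      simpa using (hasDerivWithinAt_id x (Ici x)).const_mul (m * f₀)
    exact (h1.add h4).sub h5
  · intro x hx
    have hfx := hf x hx
    have hfx0 : 0 ≤ inner ℝ (T x) e := hf₀.trans hfx
    have hwe := abs_inner_le_mul_sqrt (h.norm_tangent x) he (hw x)
    set f := inner ℝ (T x) e with hfdef
    set S := √(ε + (1 - f ^ 2)) with hS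
    have hSpos : 0 < S := Real.sqrt_pos.2 (hpos x)
    have hSS : √(1 - f ^ 2) ≤ S := Real.sqrt_le_sqrt (by linarith)
    -- The root in the denominator cancels the factor `√(1 - f²)` that bounds `⟨w, e⟩ / ‖w‖`. The
    -- derivative is therefore at least `(v - r ‖w‖) f - m f₀`, for either sign `q`.
    have h1 : |q * (r * ((-(2 * f * inner ℝ (w x) e)) / (2 * S)))| ≤ r * ‖w x‖ * f := by
      have : (-(2 * f * inner ℝ (w x) e)) / (2 * S) = - (f * inner ℝ (w x) e / S) := by
        field_simp
      rw [this, abs_mul, hq, one_mul, abs_mul, abs_of_nonneg hr, abs_neg, abs_div, abs_mul,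
        abs_of_nonneg hfx0, abs_of_pos hSpos, mul_assoc]
      refine mul_le_mul_of_nonneg_left ?_ hr
      rw [div_le_iff₀ hSpos]
      calc f * |inner ℝ (w x) e| ≤ f * (‖w x‖ * S) :=
            mul_le_mul_of_nonneg_left
              (hwe.trans (mul_le_mul_of_nonneg_left hSS (norm_nonneg _))) hfx0
        _ = ‖w x‖ * f * S := by ring
    have h2 := neg_le_of_abs_le h1
    have h3 : m * f ≤ (v x - r * ‖w x‖) * f := mul_le_mul_of_nonneg_right (hm x) hfx0
    have h4 : m * f₀ ≤ m * f := mul_le_mul_of_nonneg_left hfx h.margin_pos.le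
    linarith

theorem inner_tangent_self (h : IsTubeCurve L r m V c T) (s : ℝ) : inner ℝ (T s) (T s) = 1 := by
  rw [real_inner_self_eq_norm_sq, h.norm_tangent]; norm_num

theorem mul_sqrt_le_of_forall_pos {r x y : ℝ} (hr : 0 ≤ r)
    (H : ∀ δ : ℝ, 0 < δ → r * √(δ ^ 2 + y) ≤ x + r * δ) : r * √y ≤ x := by
  rcases hr.eq_or_lt with rfl | hr
  · simpa using H 1 one_pos
  refine le_of_forall_pos_le_add fun η hη => ?_
  have := H (η / r) (by positivity)
  rw [mul_div_cancel₀ _ hr.ne'] at this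
  exact (mul_le_mul_of_nonneg_left (Real.sqrt_le_sqrt (by nlinarith [sq_nonneg (η / r)]))
    hr.le).trans this

/-- Distance of the normal plane at `a` from `c b`. -/
theorem mul_sqrt_add_le_inner_left (h : IsTubeCurve L r m V c T) (hr : 0 ≤ r) {a b f₀ : ℝ}
    (hab : a ≤ b) (hf₀ : 0 ≤ f₀) (hf : ∀ u ∈ Ico a b, f₀ ≤ inner ℝ (T u) (T a)) :
    r * √(1 - inner ℝ (T b) (T a) ^ 2) + m * f₀ * (b - a) ≤ inner ℝ (c b - c a) (T a) := by
  have := mul_sqrt_le_of_forall_pos (x := inner ℝ (c b - c a) (T a) - m * f₀ * (b - a)) hr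
    fun δ hδ => by
      -- With `ε = δ²` the root at `a`, where `⟨T, e⟩ = 1`, is exactly `δ`; it disappears in the
      -- limit `δ → 0`.
      have := h.inner_add_mul_sqrt_le hr (h.norm_tangent a) (ε := δ ^ 2) (q := -1) hab hf₀
        (by positivity) (by simp) hf
      rw [h.inner_tangent_self] at this
      norm_num [Real.sqrt_sq hδ.le] at this
      rw [inner_sub_left]
      linarith
  linarith

/-- Distance of the normal plane at `b` from `c a`. -/
theorem mul_sqrt_add_le_inner_right (h : IsTubeCurve L r m V c T) (hr : 0 ≤ r) {a b f₀ : ℝ}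
    (hab : a ≤ b) (hf₀ : 0 ≤ f₀) (hf : ∀ u ∈ Ico a b, f₀ ≤ inner ℝ (T u) (T b)) :
    r * √(1 - inner ℝ (T a) (T b) ^ 2) + m * f₀ * (b - a) ≤ inner ℝ (c b - c a) (T b) := by
  have := mul_sqrt_le_of_forall_pos (x := inner ℝ (c b - c a) (T b) - m * f₀ * (b - a)) hr
    fun δ hδ => by
      have := h.inner_add_mul_sqrt_le hr (h.norm_tangent b) (ε := δ ^ 2) (q := 1) hab hf₀
        (by positivity) (by simp) hf
      rw [h.inner_tangent_self] at this
      norm_num [Real.sqrt_sq hδ.le] at this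
      rw [inner_sub_left]
      linarith
  linarith

/-- An arc that stays in a ball of radius smaller than `r` cannot turn by a right angle. -/
theorem tangent_bound_of_short (h : IsTubeCurve L r m V c T) {a b δ : ℝ} (hδr : δ < r)
    (hδ : 0 ≤ δ) (hc : ∀ u ∈ Icc a b, ‖c u - c a‖ ≤ δ) :
    ∀ u ∈ Icc a b, 0 < inner ℝ (T u) (T a) ∧ r * √(1 - inner ℝ (T u) (T a) ^ 2) ≤ δ := by
  have hr : 0 < r := hδ.trans_lt hδr
  have hcT := h.continuous_tangent
  have key : ∀ u ∈ Icc a b, (∀ x ∈ Ico a u, 0 ≤ inner ℝ (T x) (T a)) →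
      r * √(1 - inner ℝ (T u) (T a) ^ 2) ≤ δ := by
    intro u hu hx
    have h1 := h.mul_sqrt_add_le_inner_left hr.le hu.1 le_rfl hx
    have h2 := real_inner_le_norm (c u - c a) (T a)
    rw [h.norm_tangent, mul_one] at h2
    linarith [hc u hu]
  have hpos : ∀ u ∈ Icc a b, 0 < inner ℝ (T u) (T a) := by
    by_contra! hcon
    obtain ⟨u₀, hu₀, hneg⟩ := hcon
    have hcf : Continuous fun u => inner ℝ (T u) (T a) := by fun_prop
    have hK : IsCompact (Icc a b ∩ {u | inner ℝ (T u) (T a) ≤ 0}) :=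
      isCompact_Icc.inter_right (isClosed_le hcf continuous_const)
    obtain ⟨u₁, ⟨hu₁, hu₁n⟩, hmin⟩ := hK.exists_isLeast ⟨u₀, hu₀, hneg⟩
    have hbefore : ∀ x ∈ Ico a u₁, 0 < inner ℝ (T x) (T a) := by
      intro x hx
      by_contra! hle
      exact absurd (hmin ⟨⟨hx.1, hx.2.le.trans hu₁.2⟩, hle⟩) (not_le.2 hx.2)
    have hzero : inner ℝ (T u₁) (T a) = 0 := by
      obtain ⟨x, hx, hx0⟩ := intermediate_value_Icc' hu₁.1 hcf.continuousOn
        (show (0 : ℝ) ∈ Icc _ _ from ⟨hu₁n, by simp⟩)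
      rcases hx.2.eq_or_lt with rfl | hlt
      · exact hx0
      · exact absurd hx0 (hbefore x ⟨hx.1, hlt⟩).ne'
    -- At the first right angle the estimate reads `r ≤ δ`.
    have := key u₁ hu₁ fun x hx => (hbefore x hx).le
    rw [hzero] at this
    norm_num at this
    linarith
  exact fun u hu => ⟨hpos u hu, key u hu fun x hx => (hpos x ⟨hx.1, hx.2.le.trans hu.2⟩).le⟩

/-- The sine of the turning angle is at most `δ / r`, and a cosine in `(0, 1]` is at least its own
square. -/
theorem inner_ge_of_short (h : IsTubeCurve L r m V c T) {a b δ : ℝ} (hδr : δ < r)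
    (hδ : 0 ≤ δ) (hc : ∀ u ∈ Icc a b, ‖c u - c a‖ ≤ δ) :
    ∀ u ∈ Icc a b, 1 - (δ / r) ^ 2 ≤ inner ℝ (T u) (T a) := by
  intro u hu
  have hr : 0 < r := hδ.trans_lt hδr
  obtain ⟨h1, h2⟩ := h.tangent_bound_of_short hδr hδ hc u hu
  have h3 := inner_sq_le_one (h.norm_tangent u) (h.norm_tangent a)
  set f := inner ℝ (T u) (T a)
  have h4 : √(1 - f ^ 2) ≤ δ / r := by rw [le_div_iff₀ hr]; linarith
  have h5 := (Real.sqrt_le_left (by positivity)).1 h4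
  nlinarith

/-- The chord of a short arc is nonzero and almost parallel to the initial tangent. -/
theorem chord_of_short (h : IsTubeCurve L r m V c T) {a b δ : ℝ} (hδr : δ < r) (hδ : 0 ≤ δ)
    (hab : a < b) (hc : ∀ u ∈ Icc a b, ‖c u - c a‖ ≤ δ) :
    c b - c a ≠ 0 ∧ ‖T a - ‖c b - c a‖⁻¹ • (c b - c a)‖ ≤ 2 * (δ / r) := by
  have hr : 0 < r := hδ.trans_lt hδr
  have hk : 0 < 1 - (δ / r) ^ 2 := by
    have : δ / r < 1 := (div_lt_one hr).2 hδr
    have : 0 ≤ δ / r := by positivity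
    nlinarith
  set k := 1 - (δ / r) ^ 2 with hkdef
  have hf := h.inner_ge_of_short hδr hδ hc
  have hG := h.mul_sqrt_add_le_inner_left hr.le hab.le hk.le
    (fun u hu => hf u ⟨hu.1, hu.2.le⟩)
  have hX : c b - c a ≠ 0 := by
    intro h0
    rw [h0, inner_zero_left] at hG
    have : 0 < m * k * (b - a) := mul_pos (mul_pos h.margin_pos hk) (sub_pos.2 hab)
    have : 0 ≤ r * √(1 - inner ℝ (T b) (T a) ^ 2) := by positivity
    linarith
  refine ⟨hX, ?_⟩
  have hcont := h.continuous
  -- The speed is at most `1 / k` times the rate of growth in the direction `T a`, so the arc stays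
  -- in a cone about that direction.
  have hcone : ‖c b - c a‖ ≤ inner ℝ (c b - c a) (T a) / k := by
    choose v w hcd hT hw hV hm using h.exists_deriv
    refine image_norm_le_of_norm_deriv_right_le_deriv_boundary' (f := fun u => c u - c a)
      (f' := fun u => v u • T u) (a := a) (b := b)
      (B := fun u => inner ℝ (c u - c a) (T a) / k) (B' := fun u => v u * inner ℝ (T u) (T a) / k)
      (by fun_prop) (fun x _ => (hcd x).sub_const _) (by simp) (by fun_prop) ?_ ?_
      (right_mem_Icc.2 hab.le)
    · intro x _
      have := (((hcd x).sub_const (c a)).inner ℝ (hasDerivWithinAt_const x (Ici x) (T a))).div_const k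
      simpa [inner_smul_left] using this
    · intro x hx
      have hv : 0 ≤ v x := by nlinarith [hm x, mul_nonneg hr.le (norm_nonneg (w x)), h.margin_pos]
      rw [norm_smul, h.norm_tangent, mul_one, Real.norm_of_nonneg hv, le_div_iff₀ hk]
      exact mul_le_mul_of_nonneg_left (hf x ⟨hx.1, hx.2.le⟩) hv
  set X := c b - c a
  have hXn : 0 < ‖X‖ := norm_pos_iff.2 hX
  rw [le_div_iff₀ hk] at hcone
  have h1 : k ≤ inner ℝ (T a) (‖X‖⁻¹ • X) := by
    rw [inner_smul_right, real_inner_comm, ← div_eq_inv_mul, le_div_iff₀ hXn]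
    linarith
  have h2 : ‖‖X‖⁻¹ • X‖ = 1 := norm_smul_inv_norm hX
  have h3 := norm_sub_sq_real (T a) (‖X‖⁻¹ • X)
  rw [h.norm_tangent, h2] at h3
  refine abs_le_of_sq_le_sq' ?_ (by positivity) |>.2
  have : (2 * (δ / r)) ^ 2 = 4 * (δ / r) ^ 2 := by ring
  nlinarith [sq_nonneg (δ / r)]

end IsTubeCurve

/-! ### Continuity of the tangents in time -/

/-- In a continuous family of curves with curvature less than `1 / r` the tangents vary
continuously. -/
theorem continuous_tangent_family {L r : ℝ} (hr : 0 < r) {C T : I → ℝ → E3} {m V : I → ℝ}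
    (h : ∀ t, IsTubeCurve L r (m t) (V t) (C t) (T t))
    (hC : Continuous fun p : I × ℝ => C p.1 p.2) : Continuous fun p : I × ℝ => T p.1 p.2 := by
  refine continuous_iff_continuousAt.2 fun ⟨t₀, s₀⟩ => ?_
  rw [ContinuousAt, Metric.tendsto_nhds]
  intro ε hε
  obtain ⟨δ, hδ, hδr, hδε⟩ : ∃ δ, 0 < δ ∧ δ < r ∧ 2 * (δ / r) < ε / 3 := by
    refine ⟨min (r / 2) (r * ε / 12), by positivity, (min_le_left _ _).trans_lt (by linarith), ?_⟩
    have h1 : min (r / 2) (r * ε / 12) / r ≤ r * ε / 12 / r :=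
      div_le_div_of_nonneg_right (min_le_right _ _) hr.le
    have h2 : r * ε / 12 / r = ε / 12 := by field_simp
    linarith
  obtain ⟨η, hη, hnear⟩ := Metric.continuousAt_iff.1 (hC.continuousAt (x := (t₀, s₀))) (δ / 2)
    (by positivity)
  have hshort : ∀ t s, dist t t₀ < η → dist s s₀ < η / 2 →
      ∀ u ∈ Icc s (s₀ + η / 2), ‖C t u - C t s‖ ≤ δ := by
    intro t s ht hs u hu
    have hs' := abs_lt.1 (Real.dist_eq s s₀ ▸ hs)
    have h1 := hnear (x := (t, u)) (by
      rw [Prod.dist_eq]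
      refine max_lt ht ?_
      rw [Real.dist_eq, abs_lt]
      exact ⟨by linarith [hu.1], by linarith [hu.2]⟩)
    have h2 := hnear (x := (t, s)) (by
      rw [Prod.dist_eq]; exact max_lt ht (hs.trans (by linarith)))
    rw [← dist_eq_norm]
    linarith [dist_triangle_right (C t u) (C t s) (C t₀ s₀)]
  -- All chords end at the same parameter `s₀ + η / 2`. Their directions depend continuously on time
  -- and starting point, and each tangent is uniformly close to the direction of its chord.
  set X : I × ℝ → E3 := fun p => C p.1 (s₀ + η / 2) - C p.1 p.2 with hX
  have h₀ := (h t₀).chord_of_short hδr hδ.le (a := s₀) (b := s₀ + η / 2) (by linarith)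
    (hshort t₀ s₀ (by simpa using hη) (by simpa using hη))
  have hXc : Continuous X :=
    (hC.comp (continuous_fst.prodMk continuous_const)).sub hC
  have hdir : ContinuousAt (fun p => ‖X p‖⁻¹ • X p) (t₀, s₀) :=
    (hXc.norm.continuousAt.inv₀ (norm_ne_zero_iff.2 h₀.1)).smul hXc.continuousAt
  have e1 := Metric.tendsto_nhds.1 hdir (ε / 3) (by positivity)
  have e2 : ∀ᶠ p : I × ℝ in 𝓝 (t₀, s₀), dist p.1 t₀ < η ∧ dist p.2 s₀ < η / 2 := by
    filter_upwards [Metric.ball_mem_nhds (t₀, s₀) (half_pos hη)] with p hp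
    rw [Metric.mem_ball, Prod.dist_eq, max_lt_iff] at hp
    exact ⟨hp.1.trans (by linarith), hp.2⟩
  filter_upwards [e1, e2] with p hp1 hp2
  have h₁ := (h p.1).chord_of_short hδr hδ.le (a := p.2) (b := s₀ + η / 2)
    (by linarith [(abs_lt.1 (Real.dist_eq p.2 s₀ ▸ hp2.2)).2]) (hshort p.1 p.2 hp2.1 hp2.2)
  have a1 := h₁.2
  have a0 := h₀.2
  rw [← dist_eq_norm] at a0 a1
  rw [dist_comm] at a0
  calc dist (T p.1 p.2) (T t₀ s₀) ≤ dist (T p.1 p.2) (‖X p‖⁻¹ • X p) +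
        dist (‖X p‖⁻¹ • X p) (‖X (t₀, s₀)‖⁻¹ • X (t₀, s₀)) +
        dist (‖X (t₀, s₀)‖⁻¹ • X (t₀, s₀)) (T t₀ s₀) := dist_triangle4 _ _ _ _
    _ < ε := by
      have b1 : dist (T p.1 p.2) (‖X p‖⁻¹ • X p) ≤ 2 * (δ / r) := a1
      have b0 : dist (‖X (t₀, s₀)‖⁻¹ • X (t₀, s₀)) (T t₀ s₀) ≤ 2 * (δ / r) := a0
      linarith

/-! ### Local structure of the tubes of a family -/

/-- A continuous family of closed curves with continuous unit tangents for which, locally in space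
and time, the normal discs of radius `r` are disjoint and cover a neighbourhood. -/
structure IsTubeFamily (L r : ℝ) (C T : I → AddCircle L → E3) : Prop where
  continuous : Continuous fun p : I × AddCircle L => C p.1 p.2
  continuous_tangent : Continuous fun p : I × AddCircle L => T p.1 p.2
  norm_tangent : ∀ t s, ‖T t s‖ = 1
  local_disjoint : ∀ t s, ∀ᶠ p : I × AddCircle L × AddCircle L in 𝓝 (t, s, s), p.2.1 ≠ p.2.2 →
    ∀ v w, inner ℝ v (T p.1 p.2.1) = 0 → inner ℝ w (T p.1 p.2.2) = 0 → ‖v‖ ≤ r → ‖w‖ ≤ r →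
      C p.1 p.2.1 + v ≠ C p.1 p.2.2 + w
  local_cover : ∀ t s v, inner ℝ v (T t s) = 0 → ‖v‖ ≤ r → ∀ U ∈ 𝓝 s,
    ∀ᶠ p : I × E3 in 𝓝 (t, C t s + v), ∃ s' ∈ U, inner ℝ (p.2 - C p.1 s') (T p.1 s') = 0

theorem inner_gt_half {u v w : E3} (hu : ‖u‖ = 1) (hv : ‖v‖ = 1) (huw : dist u w < 1 / 4)
    (hvw : dist v w < 1 / 4) : 1 / 2 ≤ inner ℝ u v := by
  have h1 : ‖u - v‖ ≤ 1 / 2 := by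
    rw [← dist_eq_norm]; linarith [dist_triangle_right u v w]
  have h2 := norm_sub_sq_real u v
  rw [hu, hv] at h2
  nlinarith [norm_nonneg (u - v)]

namespace IsTubeCurve

variable {L r m V : ℝ} {c T : ℝ → E3}

/-- On an arc along which the tangent varies little, the normal disc at `b` lies strictly in front
of the normal plane at `a`. -/
theorem inner_add_pos_left (h : IsTubeCurve L r m V c T) {a b : ℝ} (hab : a < b)
    (hf : ∀ u ∈ Icc a b, ∀ u' ∈ Icc a b, 1 / 2 ≤ inner ℝ (T u) (T u')) {v : E3}
    (hv : inner ℝ v (T b) = 0) (hvr : ‖v‖ ≤ r) : 0 < inner ℝ (c b - c a + v) (T a) := by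
  have hr : 0 ≤ r := (norm_nonneg v).trans hvr
  have h1 := h.mul_sqrt_add_le_inner_left hr hab.le (f₀ := 1 / 2) (by norm_num)
    (fun u hu => hf u ⟨hu.1, hu.2.le⟩ a (left_mem_Icc.2 hab.le))
  have h2 := neg_le_of_abs_le (abs_inner_le_mul_sqrt (h.norm_tangent b) (h.norm_tangent a) hv)
  have h3 : 0 < m * (1 / 2) * (b - a) :=
    mul_pos (mul_pos h.margin_pos (by norm_num)) (sub_pos.2 hab)
  rw [inner_add_left]
  have h4 := mul_le_mul_of_nonneg_right hvr (Real.sqrt_nonneg (1 - inner ℝ (T b) (T a) ^ 2))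
  linarith

/-- On an arc along which the tangent varies little, the normal disc at `a` lies strictly behind
the normal plane at `b`. -/
theorem inner_sub_pos_right (h : IsTubeCurve L r m V c T) {a b : ℝ} (hab : a < b)
    (hf : ∀ u ∈ Icc a b, ∀ u' ∈ Icc a b, 1 / 2 ≤ inner ℝ (T u) (T u')) {v : E3}
    (hv : inner ℝ v (T a) = 0) (hvr : ‖v‖ ≤ r) : 0 < inner ℝ (c b - c a - v) (T b) := by
  have hr : 0 ≤ r := (norm_nonneg v).trans hvr
  have h1 := h.mul_sqrt_add_le_inner_right hr hab.le (f₀ := 1 / 2) (by norm_num)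
    (fun u hu => hf u ⟨hu.1, hu.2.le⟩ b (right_mem_Icc.2 hab.le))
  have h2 := le_of_abs_le (abs_inner_le_mul_sqrt (h.norm_tangent a) (h.norm_tangent b) hv)
  have h3 : 0 < m * (1 / 2) * (b - a) :=
    mul_pos (mul_pos h.margin_pos (by norm_num)) (sub_pos.2 hab)
  rw [inner_sub_left]
  have h4 := mul_le_mul_of_nonneg_right hvr (Real.sqrt_nonneg (1 - inner ℝ (T a) (T b) ^ 2))
  linarith

end IsTubeCurve

theorem exists_tangent_almost_constant {T : I → ℝ → E3} (hT : Continuous fun p : I × ℝ => T p.1 p.2)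
    (t₀ : I) (x₀ : ℝ) : ∃ η : ℝ, 0 < η ∧ ∀ (t : I) (x : ℝ), dist t t₀ < η → dist x x₀ < η →
      dist (T t x) (T t₀ x₀) < 1 / 4 := by
  obtain ⟨η, hη, h⟩ := Metric.continuousAt_iff.1 (hT.continuousAt (x := (t₀, x₀))) (1 / 4)
    (by norm_num)
  exact ⟨η, hη, fun t x ht hx => h (x := (t, x)) (by rw [Prod.dist_eq]; exact max_lt ht hx)⟩

/-- Close parameters on the circle lift to an arc of almost constant tangent. The disc at its later
end lies strictly in front of the normal plane at its earlier end, which contains the other disc. -/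
theorem eventually_normal_discs_disjoint {L r : ℝ} {C T : I → AddCircle L → E3}
    {m V : I → ℝ}
    (h : ∀ t, IsTubeCurve L r (m t) (V t) (fun x : ℝ => C t x) (fun x : ℝ => T t x))
    (hT' : Continuous fun p : I × ℝ => T p.1 p.2) (t₀ : I) (s₀ : AddCircle L) :
    ∀ᶠ p : I × AddCircle L × AddCircle L in 𝓝 (t₀, s₀, s₀), p.2.1 ≠ p.2.2 →
    ∀ v w, inner ℝ v (T p.1 p.2.1) = 0 → inner ℝ w (T p.1 p.2.2) = 0 → ‖v‖ ≤ r → ‖w‖ ≤ r →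
      C p.1 p.2.1 + v ≠ C p.1 p.2.2 + w := by
  have hq : IsOpenQuotientMap (fun x : ℝ => (x : AddCircle L)) :=
    QuotientAddGroup.isOpenQuotientMap_mk
  have hnorm : ∀ t s, ‖T t s‖ = 1 := fun t s => by
    obtain ⟨x, rfl⟩ := hq.surjective s
    exact (h t).norm_tangent x
  obtain ⟨x₀, rfl⟩ := hq.surjective s₀
  have hq3 := (IsOpenQuotientMap.id (X := I)).prodMap (hq.prodMap hq)
  have hmap := hq3.map_nhds_eq (t₀, x₀, x₀)
  simp only [Prod.map_apply, id_eq] at hmap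
  rw [← hmap, eventually_map]
  obtain ⟨η, hη, hnear⟩ := exists_tangent_almost_constant (T := fun t x => T t x) hT' t₀ x₀
  filter_upwards [Metric.ball_mem_nhds _ hη] with p hp hne v w hv hw hvr hwr heq
  obtain ⟨t, x, y⟩ := p
  simp only [Prod.map_apply, id_eq] at hne hv hw heq
  simp only [Metric.mem_ball, Prod.dist_eq, max_lt_iff] at hp
  obtain ⟨ht, hx, hy⟩ := hp
  have hhalf : ∀ u, dist u x₀ < η → ∀ u', dist u' x₀ < η → 1 / 2 ≤ inner ℝ (T t u) (T t u') :=
    fun u hu u' hu' => inner_gt_half (hnorm _ _) (hnorm _ _) (hnear t u ht hu) (hnear t u' ht hu')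
  have hIcc : ∀ {x y : ℝ}, dist x x₀ < η → dist y x₀ < η → ∀ u ∈ Icc x y, dist u x₀ < η := by
    intro x y hx hy u hu
    rw [Real.dist_eq, abs_lt] at *
    exact ⟨by linarith [hu.1], by linarith [hu.2]⟩
  have hxy : x ≠ y := fun e => hne (by rw [e])
  rcases hxy.lt_or_gt with hlt | hlt
  · have := (h t).inner_add_pos_left hlt (fun u hu u' hu' => hhalf u (hIcc hx hy u hu) u'
      (hIcc hx hy u' hu')) hw hwr
    beta_reduce at this
    rw [show C t y - C t x + w = v by rw [sub_add_eq_add_sub, ← heq]; abel, hv] at this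
    exact lt_irrefl _ this
  · have := (h t).inner_add_pos_left hlt (fun u hu u' hu' => hhalf u (hIcc hy hx u hu) u'
      (hIcc hy hx u' hu')) hv hvr
    beta_reduce at this
    rw [show C t x - C t y + v = w by rw [sub_add_eq_add_sub, heq]; abel, hw] at this
    exact lt_irrefl _ this

/-- A point of the disc at `x₀` is strictly in front of the normal plane at `x₀ - a` and strictly
behind the one at `x₀ + a`. Both signs persist under perturbation of point and time, and the
intermediate value theorem gives a normal plane in between that contains the perturbed point. -/
theorem eventually_exists_normal_disc {L r : ℝ} {C T : I → AddCircle L → E3}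
    {m V : I → ℝ}
    (h : ∀ t, IsTubeCurve L r (m t) (V t) (fun x : ℝ => C t x) (fun x : ℝ => T t x))
    (hC' : Continuous fun p : I × ℝ => C p.1 p.2) (hT' : Continuous fun p : I × ℝ => T p.1 p.2)
    (t₀ : I) (s₀ : AddCircle L) (v : E3) (hv : inner ℝ v (T t₀ s₀) = 0) (hvr : ‖v‖ ≤ r)
    (U : Set (AddCircle L)) (hU : U ∈ 𝓝 s₀) :
    ∀ᶠ p : I × E3 in 𝓝 (t₀, C t₀ s₀ + v), ∃ s' ∈ U, inner ℝ (p.2 - C p.1 s') (T p.1 s') = 0 := by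
  have hq : IsOpenQuotientMap (fun x : ℝ => (x : AddCircle L)) :=
    QuotientAddGroup.isOpenQuotientMap_mk
  have hnorm : ∀ t s, ‖T t s‖ = 1 := fun t s => by
    obtain ⟨x, rfl⟩ := hq.surjective s
    exact (h t).norm_tangent x
  obtain ⟨x₀, rfl⟩ := hq.surjective s₀
  simp only at hv hU ⊢
  obtain ⟨η, hη, hnear⟩ := exists_tangent_almost_constant (T := fun t x => T t x) hT' t₀ x₀
  obtain ⟨η', hη', hball⟩ := Metric.mem_nhds_iff.1 (hq.continuous.continuousAt.preimage_mem_nhds hU)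
  obtain ⟨a, ha, haη, haη'⟩ : ∃ a > 0, a < η ∧ a < η' :=
    ⟨min η η' / 2, by positivity, by linarith [min_le_left η η', lt_min hη hη'],
      by linarith [min_le_right η η', lt_min hη hη']⟩
  have hhalf : ∀ u ∈ Icc (x₀ - a) (x₀ + a), ∀ u' ∈ Icc (x₀ - a) (x₀ + a),
      1 / 2 ≤ inner ℝ (T t₀ u) (T t₀ u') := by
    have hd : ∀ u ∈ Icc (x₀ - a) (x₀ + a), dist u x₀ < η := fun u hu => by
      rw [Real.dist_eq, abs_lt]; exact ⟨by linarith [hu.1], by linarith [hu.2]⟩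
    have ht₀ : dist t₀ t₀ < η := by simpa using hη
    exact fun u hu u' hu' => inner_gt_half (hnorm _ _) (hnorm _ _) (hnear t₀ u ht₀ (hd u hu))
      (hnear t₀ u' ht₀ (hd u' hu'))
  have hright := (h t₀).inner_sub_pos_right (a := x₀) (b := x₀ + a) (by linarith)
    (fun u hu u' hu' => hhalf u ⟨by linarith [hu.1], hu.2⟩ u' ⟨by linarith [hu'.1], hu'.2⟩) hv hvr
  have hleft := (h t₀).inner_add_pos_left (a := x₀ - a) (b := x₀) (by linarith)
    (fun u hu u' hu' => hhalf u ⟨hu.1, by linarith [hu.2]⟩ u' ⟨hu'.1, by linarith [hu'.2]⟩) hv hvr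
  have hφ : ∀ x : ℝ, Continuous fun p : I × E3 => inner ℝ (p.2 - C p.1 x) (T p.1 x) := fun x => by
    have h1 : Continuous fun p : I × E3 => C p.1 (x : AddCircle L) :=
      hC'.comp (continuous_fst.prodMk continuous_const)
    have h2 : Continuous fun p : I × E3 => T p.1 (x : AddCircle L) :=
      hT'.comp (continuous_fst.prodMk continuous_const)
    exact (continuous_snd.sub h1).inner h2
  have e1 : ∀ᶠ p : I × E3 in 𝓝 (t₀, C t₀ x₀ + v),
      inner ℝ (p.2 - C p.1 (x₀ + a : ℝ)) (T p.1 (x₀ + a : ℝ)) < 0 := by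
    refine (hφ (x₀ + a)).continuousAt.eventually_lt_const ?_
    rw [← neg_pos, ← inner_neg_left]
    have : -(C t₀ x₀ + v - C t₀ (x₀ + a : ℝ)) = C t₀ (x₀ + a : ℝ) - C t₀ x₀ - v := by abel
    exact this ▸ hright
  have e2 : ∀ᶠ p : I × E3 in 𝓝 (t₀, C t₀ x₀ + v),
      0 < inner ℝ (p.2 - C p.1 (x₀ - a : ℝ)) (T p.1 (x₀ - a : ℝ)) := by
    refine (hφ (x₀ - a)).continuousAt.eventually_const_lt ?_
    have : C t₀ x₀ + v - C t₀ (x₀ - a : ℝ) = C t₀ x₀ - C t₀ (x₀ - a : ℝ) + v := by abel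
    beta_reduce; exact this ▸ hleft
  filter_upwards [e1, e2] with p hp1 hp2
  have hcC := (h p.1).continuous
  have hcT := (h p.1).continuous_tangent
  obtain ⟨x, hx, hx0⟩ := intermediate_value_Icc' (a := x₀ - a) (b := x₀ + a) (by linarith)
    (f := fun x : ℝ => inner ℝ (p.2 - C p.1 x) (T p.1 x))
    ((continuous_const.sub hcC).inner hcT).continuousOn
    (show (0 : ℝ) ∈ Icc _ _ from ⟨hp1.le, hp2.le⟩)
  refine ⟨x, hball ?_, hx0⟩
  rw [Metric.mem_ball, Real.dist_eq, abs_lt]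
  exact ⟨by linarith [hx.1], by linarith [hx.2]⟩


/-- A family of tube curves on the circle is a tube family. -/
theorem isTubeFamily_of_isTubeCurve {L r : ℝ} (hr : 0 < r) {C T : I → AddCircle L → E3}
    {m V : I → ℝ}
    (h : ∀ t, IsTubeCurve L r (m t) (V t) (fun x : ℝ => C t x) (fun x : ℝ => T t x))
    (hC : Continuous fun p : I × AddCircle L => C p.1 p.2) : IsTubeFamily L r C T := by
  have hq : IsOpenQuotientMap (fun x : ℝ => (x : AddCircle L)) :=
    QuotientAddGroup.isOpenQuotientMap_mk
  have hnorm : ∀ t s, ‖T t s‖ = 1 := fun t s => by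
    obtain ⟨x, rfl⟩ := hq.surjective s
    exact (h t).norm_tangent x
  have hqI := (IsOpenQuotientMap.id (X := I)).prodMap hq
  have hC' : Continuous fun p : I × ℝ => C p.1 p.2 := hC.comp hqI.continuous
  have hT' : Continuous fun p : I × ℝ => T p.1 p.2 := continuous_tangent_family hr h hC'
  exact ⟨hC, hqI.continuous_comp_iff.1 hT', hnorm, eventually_normal_discs_disjoint h hT',
    eventually_exists_normal_disc h hC' hT'⟩

/-! ### Orthonormal frames -/

theorem inner_cross_left (t n : E3) : inner ℝ (cross t n) t = 0 := by
  simp [cross, crossProduct, PiLp.inner_apply, Fin.sum_univ_three]; ring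

theorem inner_cross_right (t n : E3) : inner ℝ (cross t n) n = 0 := by
  simp [cross, crossProduct, PiLp.inner_apply, Fin.sum_univ_three]; ring

theorem norm_cross {t n : E3} (ht : ‖t‖ = 1) (hn : ‖n‖ = 1) (htn : inner ℝ t n = 0) :
    ‖cross t n‖ = 1 := by
  have h1 : inner ℝ (cross t n) (cross t n) =
      inner ℝ t t * inner ℝ n n - inner ℝ t n ^ 2 := by
    simp only [PiLp.inner_apply]
    simp [cross, crossProduct, Fin.sum_univ_three]; ring
  rw [real_inner_self_eq_norm_sq, real_inner_self_eq_norm_sq, real_inner_self_eq_norm_sq, ht, hn,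
    htn] at h1
  nlinarith [norm_nonneg (cross t n)]

theorem eq_frame_combination {t n : E3} (ht : ‖t‖ = 1) (hn : ‖n‖ = 1) (htn : inner ℝ t n = 0)
    {v : E3} (hv : inner ℝ v t = 0) :
    v = inner ℝ n v • n + inner ℝ (cross t n) v • cross t n := by
  have ho : Orthonormal ℝ ![t, n, cross t n] := by
    have h1 := inner_cross_left t n
    have h2 := inner_cross_right t n
    have h3 := norm_cross ht hn htn
    constructor
    · intro i; fin_cases i <;> simp [ht, hn, h3]
    · intro i j hij
      fin_cases i <;> fin_cases j <;>
        simp_all [real_inner_comm t n, real_inner_comm (cross t n)]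
  let B := (basisOfOrthonormalOfCardEqFinrank ho (by simp)).toOrthonormalBasis (by simpa using ho)
  have := B.sum_repr' v
  simp only [B, Fin.sum_univ_three, Module.Basis.coe_toOrthonormalBasis,
    coe_basisOfOrthonormalOfCardEqFinrank] at this
  simp only [Matrix.cons_val_zero, Matrix.cons_val_one, Matrix.cons_val] at this
  rw [real_inner_comm t v] at hv
  rw [hv, zero_smul, zero_add] at this
  exact this.symm

theorem norm_frame_combination {t n : E3} (ht : ‖t‖ = 1) (hn : ‖n‖ = 1) (htn : inner ℝ t n = 0)
    (a b : ℝ) : ‖a • n + b • cross t n‖ ^ 2 = a ^ 2 + b ^ 2 := by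
  have h2 := inner_cross_right t n
  rw [real_inner_comm] at h2
  rw [norm_add_sq_real, norm_smul, norm_smul, hn, norm_cross ht hn htn, inner_smul_left,
    inner_smul_right, h2]
  simp

theorem norm_frame_cos_sin {t n : E3} (ht : ‖t‖ = 1) (hn : ‖n‖ = 1) (htn : inner ℝ t n = 0)
    {ρ : ℝ} (hρ : 0 ≤ ρ) (θ : ℝ) :
    ‖(ρ * Real.cos θ) • n + (ρ * Real.sin θ) • cross t n‖ = ρ := by
  have := norm_frame_combination ht hn htn (ρ * Real.cos θ) (ρ * Real.sin θ)
  have h2 : (ρ * Real.cos θ) ^ 2 + (ρ * Real.sin θ) ^ 2 = ρ ^ 2 := by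
    rw [mul_pow, mul_pow, ← mul_add, Real.cos_sq_add_sin_sq, mul_one]
  rw [h2] at this
  exact (sq_eq_sq₀ (norm_nonneg _) hρ).1 this

theorem inner_frame_combination {t n : E3} (htn : inner ℝ t n = 0) (a b : ℝ) :
    inner ℝ (a • n + b • cross t n) t = 0 := by
  rw [inner_add_left, inner_smul_left, inner_smul_left, inner_cross_left, real_inner_comm, htn]
  simp

/-- Polar coordinates in the plane orthogonal to `t`. -/
theorem exists_polar {t n : E3} (ht : ‖t‖ = 1) (hn : ‖n‖ = 1) (htn : inner ℝ t n = 0) {v : E3}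
    (hv : inner ℝ v t = 0) : ∃ θ ∈ Icc 0 (2 * Real.pi),
      v = (‖v‖ * Real.cos θ) • n + (‖v‖ * Real.sin θ) • cross t n := by
  have h1 := eq_frame_combination ht hn htn hv
  have h2 := norm_frame_combination ht hn htn (inner ℝ n v) (inner ℝ (cross t n) v)
  rw [← h1] at h2
  set z : ℂ := ⟨inner ℝ n v, inner ℝ (cross t n) v⟩ with hz
  have hzn : ‖z‖ = ‖v‖ := by
    rw [← sq_eq_sq₀ (norm_nonneg _) (norm_nonneg _), h2, Complex.sq_norm, Complex.normSq_apply]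
    simp only [hz]; ring
  have hcos : ‖v‖ * Real.cos z.arg = inner ℝ n v := by rw [← hzn, Complex.norm_mul_cos_arg]
  have hsin : ‖v‖ * Real.sin z.arg = inner ℝ (cross t n) v := by
    rw [← hzn, Complex.norm_mul_sin_arg]
  have hπ := Real.pi_pos
  rcases le_or_gt 0 z.arg with h0 | h0
  · exact ⟨z.arg, ⟨h0, by linarith [Complex.arg_le_pi z]⟩, by rw [hcos, hsin]; exact h1⟩
  · refine ⟨z.arg + 2 * Real.pi, ⟨by linarith [Complex.neg_pi_lt_arg z], by linarith⟩, ?_⟩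
    rw [Real.cos_add_two_pi, Real.sin_add_two_pi, hcos, hsin]; exact h1

/-! ### The solid torus and its boundary -/

/-- The clopen argument in the form used for overlaps: relative openness is checked pointwise in the
ambient space, and one missing point is supplied by the farthest point of the tube. -/
theorem IsPreconnected.eq_empty_of_isClosed_of_relOpen {X : Type*} [TopologicalSpace X]
    {S Q : Set X} (hS : IsPreconnected S) (hQ : IsClosed Q) (hQS : Q ⊆ S)
    (hopen : ∀ x ∈ Q, ∀ᶠ y in 𝓝 x, y ∈ S → y ∈ Q) (hne : ∃ x ∈ S, x ∉ Q) : Q = ∅ := by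
  by_contra hQe
  obtain ⟨q, hq⟩ := nonempty_iff_ne_empty.2 hQe
  obtain ⟨x, hxS, hxQ⟩ := hne
  obtain ⟨y, hyS, hyu, hyv⟩ := hS {y | ∀ᶠ z in 𝓝 y, z ∈ S → z ∈ Q} Qᶜ
    isOpen_setOfPred_eventually_nhds hQ.isOpen_compl
    (fun y _ => or_iff_not_imp_right.2 fun h => hopen y (not_not.1 h))
    ⟨q, hQS hq, hopen q hq⟩ ⟨x, hxS, hxQ⟩
  exact hyv ((mem_of_mem_nhds hyu : y ∈ S → y ∈ Q) hyS)

section Torus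

variable {L : ℝ} {T : AddCircle L → E3} {r : ℝ}

/-- The solid torus of normal vectors of length at most `r`. -/
def solidTorus (r : ℝ) (T : AddCircle L → E3) : Set (AddCircle L × E3) :=
  {x | inner ℝ x.2 (T x.1) = 0 ∧ ‖x.2‖ ≤ r}

/-- The torus of normal vectors of length `r`. -/
def boundaryTorus (r : ℝ) (T : AddCircle L → E3) : Set (AddCircle L × E3) :=
  {x | inner ℝ x.2 (T x.1) = 0 ∧ ‖x.2‖ = r}

theorem isCompact_solidTorus [Fact (0 < L)] (hT : Continuous T) : IsCompact (solidTorus r T) := by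
  refine IsCompact.of_isClosed_subset
    (isCompact_univ.prod (isCompact_closedBall (0 : E3) r)) ?_ ?_
  · have h1 : IsClosed {x : AddCircle L × E3 | inner ℝ x.2 (T x.1) = 0} :=
      isClosed_eq (by fun_prop) continuous_const
    have h2 : IsClosed {x : AddCircle L × E3 | ‖x.2‖ ≤ r} :=
      isClosed_le (by fun_prop) continuous_const
    exact h1.inter h2
  · exact fun x hx => ⟨mem_univ _, by simpa using hx.2⟩

theorem isCompact_boundaryTorus [Fact (0 < L)] (hT : Continuous T) : IsCompact (boundaryTorus r T) := by
  refine (isCompact_solidTorus (r := r) hT).of_isClosed_subset ?_ fun x hx => ⟨hx.1, hx.2.le⟩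
  have h1 : IsClosed {x : AddCircle L × E3 | inner ℝ x.2 (T x.1) = 0} :=
    isClosed_eq (by fun_prop) continuous_const
  have h2 : IsClosed {x : AddCircle L × E3 | ‖x.2‖ = r} :=
    isClosed_eq (by fun_prop) continuous_const
  exact h1.inter h2

/-- Projecting each vector to the normal plane does not lengthen it, so the solid torus is a
continuous image of circle times ball. -/
theorem isPreconnected_solidTorus (hT : Continuous T) (hT1 : ∀ s, ‖T s‖ = 1) :
    IsPreconnected (solidTorus r T) := by
  have himage : solidTorus r T = (fun x : AddCircle L × E3 => (x.1, x.2 - inner ℝ x.2 (T x.1) • T x.1))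
      '' (univ ×ˢ Metric.closedBall 0 r) := by
    ext ⟨s, v⟩
    constructor
    · rintro ⟨h1, h2⟩
      simp only at h1 h2
      exact ⟨(s, v), ⟨mem_univ _, by simpa using h2⟩, by simp [h1]⟩
    · rintro ⟨⟨s', w⟩, ⟨-, hw⟩, h⟩
      simp only [Prod.mk.injEq] at h
      obtain ⟨rfl, rfl⟩ := h
      refine ⟨by simp [inner_sub_left, inner_smul_left, hT1], ?_⟩
      have h1 := norm_sub_sq_real w (inner ℝ w (T s') • T s')
      rw [norm_smul, hT1, mul_one, Real.norm_eq_abs, sq_abs, inner_smul_right] at h1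
      have hw' : ‖w‖ ≤ r := by simpa using hw
      refine le_trans (abs_le_of_sq_le_sq' ?_ (norm_nonneg w)).2 hw'
      nlinarith [sq_nonneg (inner ℝ w (T s'))]
  rw [himage]
  refine IsPreconnected.image ?_ _ (by fun_prop)
  exact isPreconnected_univ.prod (convex_closedBall (0 : E3) r).isPreconnected

/-- The projection to the circle is a closed surjection with connected fibres. A normal frame is
needed in one fibre at a time only, never a continuous one along the curve. -/
theorem isPreconnected_boundaryTorus [Fact (0 < L)] (hr : 0 ≤ r)
    (hT : Continuous T) (hT1 : ∀ s, ‖T s‖ = 1) :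
    IsPreconnected (boundaryTorus r T) := by
  let f : boundaryTorus r T → AddCircle L := fun x => x.1.1
  have hf : Continuous f := by fun_prop
  have : CompactSpace (boundaryTorus r T) :=
    isCompact_iff_compactSpace.1 (isCompact_boundaryTorus hT)
  have hfib : ∀ s, IsConnected (f ⁻¹' {s}) := by
    intro s
    obtain ⟨n, hn, htn⟩ := exists_unit_orthogonal (T s)
    let g : ℝ → boundaryTorus r T := fun θ =>
      ⟨(s, (r * Real.cos θ) • n + (r * Real.sin θ) • cross (T s) n),
        inner_frame_combination htn _ _, norm_frame_cos_sin (hT1 s) hn htn hr θ⟩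
    have hg : Continuous g := by
      refine Continuous.subtype_mk ?_ _
      fun_prop
    have : f ⁻¹' {s} = range g := by
      ext ⟨⟨s', v⟩, h1, h2⟩
      constructor
      · intro (hs : s' = s)
        subst hs
        obtain ⟨θ, -, hθ⟩ := exists_polar (hT1 s') hn htn h1
        simp only at h2
        rw [h2] at hθ
        exact ⟨θ, Subtype.ext (Prod.ext rfl hθ.symm)⟩
      · rintro ⟨θ, hθ⟩
        exact (congrArg (fun x => x.1.1) hθ).symm
    rw [this]
    exact isConnected_range hg
  have hsurj : Function.Surjective f := fun s => (hfib s).nonempty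
  have hq : IsQuotientMap f := hf.isClosedMap.isQuotientMap hf hsurj
  have hpre := hq.isCoinducing.isConnected_preimage_of_isClosed hfib isClosed_univ isConnected_univ
  rw [preimage_univ] at hpre
  have : PreconnectedSpace (boundaryTorus r T) := ⟨hpre.isPreconnected⟩
  exact isPreconnected_iff_preconnectedSpace.2 this

end Torus

/-! ### Overlapping tubes -/

/-- The pairs of points of the tube at time `t` that lie in distinct cross-sections and occupy the
same place. -/
def overlaps {L : ℝ} (r : ℝ) (C T : I → AddCircle L → E3) :
    Set (I × (AddCircle L × E3) × (AddCircle L × E3)) :=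
  {p | (p.2.1 ∈ solidTorus r (T p.1) ∧ p.2.2 ∈ solidTorus r (T p.1) ∧
    C p.1 p.2.1.1 + p.2.1.2 = C p.1 p.2.2.1 + p.2.2.2) ∧ p.2.1.1 ≠ p.2.2.1}

namespace IsTubeFamily

variable {L r : ℝ} {C T : I → AddCircle L → E3}

theorem overlaps_symm {t : I} {x y : AddCircle L × E3} (h : (t, x, y) ∈ overlaps r C T) :
    (t, y, x) ∈ overlaps r C T :=
  ⟨⟨h.1.2.1, h.1.1, h.1.2.2.symm⟩, h.2.symm⟩

/-- Being in distinct cross-sections is an open condition; it survives limits because nearby normal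
discs are disjoint. -/
theorem isClosed_overlaps (F : IsTubeFamily L r C T) : IsClosed (overlaps r C T) := by
  have hC := F.continuous
  have hT := F.continuous_tangent
  refine isClosed_of_closure_subset fun p hp => ?_
  have hclosed : IsClosed {p : I × (AddCircle L × E3) × (AddCircle L × E3) |
      p.2.1 ∈ solidTorus r (T p.1) ∧ p.2.2 ∈ solidTorus r (T p.1) ∧
      C p.1 p.2.1.1 + p.2.1.2 = C p.1 p.2.2.1 + p.2.2.2} := by
    have c1 : Continuous fun p : I × (AddCircle L × E3) × (AddCircle L × E3) => C p.1 p.2.1.1 :=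
      hC.comp (by fun_prop : Continuous fun p : I × (AddCircle L × E3) × (AddCircle L × E3) =>
        (p.1, p.2.1.1))
    have c2 : Continuous fun p : I × (AddCircle L × E3) × (AddCircle L × E3) => C p.1 p.2.2.1 :=
      hC.comp (by fun_prop : Continuous fun p : I × (AddCircle L × E3) × (AddCircle L × E3) =>
        (p.1, p.2.2.1))
    have d1 : Continuous fun p : I × (AddCircle L × E3) × (AddCircle L × E3) => T p.1 p.2.1.1 :=
      hT.comp (by fun_prop : Continuous fun p : I × (AddCircle L × E3) × (AddCircle L × E3) =>
        (p.1, p.2.1.1))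
    have d2 : Continuous fun p : I × (AddCircle L × E3) × (AddCircle L × E3) => T p.1 p.2.2.1 :=
      hT.comp (by fun_prop : Continuous fun p : I × (AddCircle L × E3) × (AddCircle L × E3) =>
        (p.1, p.2.2.1))
    have e1 : Continuous fun p : I × (AddCircle L × E3) × (AddCircle L × E3) => p.2.1.2 := by
      fun_prop
    have e2 : Continuous fun p : I × (AddCircle L × E3) × (AddCircle L × E3) => p.2.2.2 := by
      fun_prop
    have k1 := (isClosed_eq (e1.inner (𝕜 := ℝ) d1) (continuous_const (y := (0 : ℝ)))).inter
      (isClosed_le e1.norm (continuous_const (y := r)))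
    have k2 := (isClosed_eq (e2.inner (𝕜 := ℝ) d2) (continuous_const (y := (0 : ℝ)))).inter
      (isClosed_le e2.norm (continuous_const (y := r)))
    exact k1.inter (k2.inter (isClosed_eq (c1.add e1) (c2.add e2)))
  refine ⟨hclosed.closure_subset_iff.2 (fun q hq => hq.1) hp, fun heq => ?_⟩
  obtain ⟨t, ⟨s, v⟩, ⟨s', v'⟩⟩ := p
  simp only at heq
  subst heq
  have hcont : Continuous fun p : I × (AddCircle L × E3) × (AddCircle L × E3) =>
      (p.1, p.2.1.1, p.2.2.1) := by fun_prop
  have hev := (hcont.tendsto (t, (s, v), (s, v'))).eventually (F.local_disjoint t s)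
  obtain ⟨q, hq, hq'⟩ := ((mem_closure_iff_frequently.1 hp).and_eventually hev).exists
  exact hq' hq.2 _ _ hq.1.1.1 hq.1.2.1.1 hq.1.1.2 hq.1.2.1.2 hq.1.2.2

theorem isCompact_overlaps [Fact (0 < L)] (F : IsTubeFamily L r C T) : IsCompact (overlaps r C T) := by
  refine IsCompact.of_isClosed_subset (isCompact_univ.prod
    ((isCompact_univ.prod (isCompact_closedBall (0 : E3) r)).prod
      (isCompact_univ.prod (isCompact_closedBall (0 : E3) r)))) F.isClosed_overlaps ?_
  exact fun p hp => ⟨mem_univ _, ⟨mem_univ _, by simpa using hp.1.1.2⟩,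
    ⟨mem_univ _, by simpa using hp.1.2.1.2⟩⟩

/-- The set of times with self-contact is closed. -/
theorem isClosed_selfContact [Fact (0 < L)] (F : IsTubeFamily L r C T) :
    IsClosed {t : I | ∃ x y, (t, x, y) ∈ overlaps r C T ∧ ‖x.2‖ = r ∧ ‖y.2‖ = r} := by
  have hcl : IsClosed {p : I × (AddCircle L × E3) × (AddCircle L × E3) |
      ‖p.2.1.2‖ = r ∧ ‖p.2.2.2‖ = r} :=
    (isClosed_eq (by fun_prop) continuous_const).inter (isClosed_eq (by fun_prop) continuous_const)
  have := ((F.isCompact_overlaps.inter_right hcl).image continuous_fst).isClosed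
  convert this using 1
  ext t
  constructor
  · rintro ⟨x, y, h, hx, hy⟩; exact ⟨(t, x, y), ⟨h, hx, hy⟩, rfl⟩
  · rintro ⟨⟨t, x, y⟩, ⟨h, hx, hy⟩, rfl⟩; exact ⟨x, y, h, hx, hy⟩

/-- The interior of the tube covers a neighbourhood of each of its points, locally uniformly. -/
theorem eventually_exists_interior (F : IsTubeFamily L r C T) {t : I} {y : AddCircle L × E3}
    (hy : inner ℝ y.2 (T t y.1) = 0) (hyr : ‖y.2‖ < r) {U : Set (AddCircle L)} (hU : U ∈ 𝓝 y.1) :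
    ∀ᶠ p : I × E3 in 𝓝 (t, C t y.1 + y.2), ∃ y' ∈ solidTorus r (T p.1),
      y'.1 ∈ U ∧ ‖y'.2‖ < r ∧ C p.1 y'.1 + y'.2 = p.2 := by
  have hcont : Continuous fun q : AddCircle L × I × E3 => ‖q.2.2 - C q.2.1 q.1‖ := by
    have : Continuous fun q : AddCircle L × I × E3 => C q.2.1 q.1 :=
      F.continuous.comp (by fun_prop : Continuous fun q : AddCircle L × I × E3 => (q.2.1, q.1))
    exact (continuous_snd.comp continuous_snd |>.sub this).norm
  have hev : ∀ᶠ q : AddCircle L × I × E3 in 𝓝 (y.1, (t, C t y.1 + y.2)),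
      ‖q.2.2 - C q.2.1 q.1‖ < r := by
    refine hcont.continuousAt.eventually_lt_const ?_
    simpa using hyr
  rw [nhds_prod_eq] at hev
  obtain ⟨pa, ha, pb, hb, hab⟩ := eventually_prod_iff.1 hev
  filter_upwards [F.local_cover t y.1 y.2 hy hyr.le _ (inter_mem hU ha), hb] with p hp hbp
  obtain ⟨s', ⟨hs'U, hs'a⟩, hs'⟩ := hp
  have := hab hs'a hbp
  exact ⟨(s', p.2 - C p.1 s'), ⟨hs', this.le⟩, hs'U, this, by simp⟩

/-- Overlap with an interior point persists under small perturbations. -/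
theorem eventually_overlaps (F : IsTubeFamily L r C T) {t : I} {x y : AddCircle L × E3}
    (h : (t, x, y) ∈ overlaps r C T) (hy : ‖y.2‖ < r) :
    ∀ᶠ p : I × AddCircle L × E3 in 𝓝 (t, x), p.2 ∈ solidTorus r (T p.1) →
      ∃ y', (p.1, p.2, y') ∈ overlaps r C T := by
  obtain ⟨U₁, U₂, hU₁, hU₂, hx₁, hy₂, hd⟩ := t2_separation h.2
  have hcont : Continuous fun p : I × AddCircle L × E3 => (p.1, C p.1 p.2.1 + p.2.2) := by
    have : Continuous fun p : I × AddCircle L × E3 => C p.1 p.2.1 :=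
      F.continuous.comp (by fun_prop : Continuous fun p : I × AddCircle L × E3 => (p.1, p.2.1))
    exact continuous_fst.prodMk (this.add (continuous_snd.comp continuous_snd))
  have hev := F.eventually_exists_interior h.1.2.1.1 hy (hU₂.mem_nhds hy₂)
  have heq : C t y.1 + y.2 = C t x.1 + x.2 := h.1.2.2.symm
  simp only at hev
  rw [heq] at hev
  have hU₁' : ∀ᶠ p : I × AddCircle L × E3 in 𝓝 (t, x), p.2.1 ∈ U₁ :=
    (by fun_prop : Continuous fun p : I × AddCircle L × E3 => p.2.1).continuousAt.preimage_mem_nhds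
      (hU₁.mem_nhds hx₁)
  filter_upwards [(hcont.tendsto (t, x)).eventually hev, hU₁'] with p hp hpU hpD
  obtain ⟨y', hy'D, hy'U, -, hy'⟩ := hp
  exact ⟨y', ⟨hpD, hy'D, hy'.symm⟩, fun e => disjoint_left.1 hd hpU (e ▸ hy'U)⟩

/-- The tube covers a full neighbourhood of the position of an interior point, and such a
neighbourhood contains points farther from the origin. -/
theorem not_maximal_of_interior (F : IsTubeFamily L r C T) {t : I} {y : AddCircle L × E3}
    (hy : inner ℝ y.2 (T t y.1) = 0) (hyr : ‖y.2‖ < r) :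
    ¬ ∀ x ∈ solidTorus r (T t), ‖C t x.1 + x.2‖ ≤ ‖C t y.1 + y.2‖ := by
  intro hmax
  have hev := F.eventually_exists_interior hy hyr univ_mem
  have hev' : ∀ᶠ z in 𝓝 (C t y.1 + y.2), z ∈ Metric.closedBall (0 : E3) ‖C t y.1 + y.2‖ := by
    filter_upwards [((Continuous.prodMk_right t).tendsto _).eventually hev] with z hz
    obtain ⟨x, hx, -, -, rfl⟩ := hz
    simpa using hmax x hx
  have : C t y.1 + y.2 ∈ interior (Metric.closedBall (0 : E3) ‖C t y.1 + y.2‖) :=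
    mem_interior_iff_mem_nhds.2 hev'
  rw [interior_closedBall'] at this
  simp at this

/-- A tube without self-contact is embedded. -/
theorem selfContact_of_overlaps [Fact (0 < L)] (hr : 0 < r) (F : IsTubeFamily L r C T) {t : I}
    {x₀ y₀ : AddCircle L × E3} (h₀ : (t, x₀, y₀) ∈ overlaps r C T) :
    ∃ x y, (t, x, y) ∈ overlaps r C T ∧ ‖x.2‖ = r ∧ ‖y.2‖ = r := by
  by_contra! hno
  have hTt : Continuous (T t) := F.continuous_tangent.comp (Continuous.prodMk_right t)
  have hCt : Continuous (C t) := F.continuous.comp (Continuous.prodMk_right t)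
  have hsec : ∀ S : Set (AddCircle L × E3), IsClosed S →
      IsClosed {x | x ∈ S ∧ ∃ y, (t, x, y) ∈ overlaps r C T} := by
    intro S hS
    have hcl : IsClosed {p : I × (AddCircle L × E3) × (AddCircle L × E3) | p.1 = t ∧ p.2.1 ∈ S} :=
      (isClosed_eq continuous_fst continuous_const).inter
        (hS.preimage (continuous_fst.comp continuous_snd))
    convert ((F.isCompact_overlaps.inter_right hcl).image
      (continuous_fst.comp continuous_snd)).isClosed using 1
    ext x
    constructor
    · rintro ⟨hx, y, hy⟩; exact ⟨(t, x, y), ⟨hy, rfl, hx⟩, rfl⟩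
    · rintro ⟨⟨t, x, y⟩, ⟨h, rfl, hx⟩, rfl⟩; exact ⟨hx, y, h⟩
  have hopen : ∀ x y, (t, x, y) ∈ overlaps r C T → ‖y.2‖ < r →
      ∀ᶠ x' in 𝓝 x, x' ∈ solidTorus r (T t) → ∃ y', (t, x', y') ∈ overlaps r C T :=
    fun x y h hy => ((Continuous.prodMk_right t).tendsto x).eventually (F.eventually_overlaps h hy)
  have hcE : ContinuousOn (fun x : AddCircle L × E3 => ‖C t x.1 + x.2‖) (solidTorus r (T t)) := by
    fun_prop
  obtain ⟨z, hzD, hz⟩ := (isCompact_solidTorus hTt).exists_isMaxOn ⟨x₀, h₀.1.1⟩ hcE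
  have hmax : ∀ y : AddCircle L × E3, inner ℝ y.2 (T t y.1) = 0 → ‖y.2‖ ≤ r → C t y.1 + y.2 = C t z.1 + z.2 →
      ‖y.2‖ = r := by
    intro y hy hyr heq
    by_contra hne
    refine F.not_maximal_of_interior hy (lt_of_le_of_ne hyr hne) fun x hx => ?_
    rw [heq]
    exact hz hx
  have hzr : ‖z.2‖ = r := hmax z hzD.1 hzD.2 rfl
  -- A partner of `z` occupies the same farthest place, so it too lies on the boundary, which is the
  -- excluded contact.
  have hzno : ∀ y, (t, z, y) ∉ overlaps r C T := fun y hy =>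
    hno z y hy hzr (hmax y hy.1.2.1.1 hy.1.2.1.2 hy.1.2.2.symm)
  have hbd : {x | x ∈ boundaryTorus r (T t) ∧ ∃ y, (t, x, y) ∈ overlaps r C T} = ∅ := by
    refine IsPreconnected.eq_empty_of_isClosed_of_relOpen
      (isPreconnected_boundaryTorus hr.le hTt (F.norm_tangent t))
      (hsec _ (isCompact_boundaryTorus hTt).isClosed) (fun x hx => hx.1) ?_
      ⟨z, ⟨hzD.1, hzr⟩, fun h => h.2.elim fun y hy => hzno y hy⟩
    rintro x ⟨hx, y, hy⟩
    filter_upwards [hopen x y hy (lt_of_le_of_ne hy.1.2.1.2 (hno x y hy hx.2))] with x' hx' hx'b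
    exact ⟨hx'b, hx' ⟨hx'b.1, hx'b.2.le⟩⟩
  have hall : {x | x ∈ solidTorus r (T t) ∧ ∃ y, (t, x, y) ∈ overlaps r C T} = ∅ := by
    refine IsPreconnected.eq_empty_of_isClosed_of_relOpen
      (isPreconnected_solidTorus hTt (F.norm_tangent t))
      (hsec _ (isCompact_solidTorus hTt).isClosed) (fun x hx => hx.1) ?_
      ⟨z, hzD, fun h => h.2.elim fun y hy => hzno y hy⟩
    rintro x ⟨hx, y, hy⟩
    -- Overlap is symmetric, so a partner on the boundary would be a boundary point having a
    -- partner.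
    have hyr : ‖y.2‖ < r := lt_of_le_of_ne hy.1.2.1.2 fun e =>
      (hbd.subset ⟨⟨hy.1.2.1.1, e⟩, x, overlaps_symm hy⟩ : y ∈ (∅ : Set (AddCircle L × E3)))
    filter_upwards [hopen x y hy hyr] with x' hx' hx'D
    exact ⟨hx'D, hx' hx'D⟩
  exact (hall.subset ⟨h₀.1.1, y₀, h₀⟩ : x₀ ∈ (∅ : Set (AddCircle L × E3)))

/-- If the curve at time `t` passes twice through one point, nearby tubes have self-contact. -/
theorem eventually_selfContact [Fact (0 < L)] (hr : 0 < r) (F : IsTubeFamily L r C T) {t : I}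
    {s s' : AddCircle L}
    (hne : s ≠ s') (heq : C t s = C t s') :
    ∀ᶠ t' in 𝓝 t, ∃ x y, (t', x, y) ∈ overlaps r C T ∧ ‖x.2‖ = r ∧ ‖y.2‖ = r := by
  have h : (t, (s, (0 : E3)), (s', (0 : E3))) ∈ overlaps r C T :=
    ⟨⟨⟨by simp, by simpa using hr.le⟩, ⟨by simp, by simpa using hr.le⟩, by simpa using heq⟩, hne⟩
  have hev := F.eventually_overlaps h (by simpa using hr)
  have hcont : Continuous fun t' : I => (t', s, (0 : E3)) := by fun_prop
  filter_upwards [(hcont.tendsto t).eventually hev] with t' ht'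
  obtain ⟨y, hy⟩ := ht' ⟨by simp, by simpa using hr.le⟩
  exact F.selfContact_of_overlaps hr hy

end IsTubeFamily

/-! ### Ambient isotopy -/

theorem AmbientIsotopic.refl (L : ℝ) (K : ℝ → E3) : AmbientIsotopic L K K :=
  ⟨fun p => p.1, continuous_fst, fun _ => IsHomeomorph.id, fun _ => rfl, fun _ _ => rfl⟩

theorem AmbientIsotopic.trans {L : ℝ} {K₀ K₁ K₂ : ℝ → E3} (h₁ : AmbientIsotopic L K₀ K₁)
    (h₂ : AmbientIsotopic L K₁ K₂) : AmbientIsotopic L K₀ K₂ := by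
  obtain ⟨G, hG, hGh, hG0, hG1⟩ := h₁
  obtain ⟨G', hG', hG'h, hG'0, hG'1⟩ := h₂
  refine ⟨fun p => G' (G p, p.2), by fun_prop, fun t => (hG'h t).comp (hGh t),
    fun x => by simp only [hG0, hG'0], fun s hs => ?_⟩
  simp only [hG1 s hs, hG'1 s hs]

/-- A perturbation of the identity of `E3` by a Lipschitz map of constant less than `1` is a
homeomorphism. -/
theorem isHomeomorph_id_add {φ : E3 → E3} {k : NNReal} (hk : k < 1) (hφ : LipschitzWith k φ) :
    IsHomeomorph fun x => x + φ x := by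
  have happ : ApproximatesLinearOn (fun x => x + φ x)
      ((ContinuousLinearEquiv.refl ℝ E3 : E3 ≃L[ℝ] E3) : E3 →L[ℝ] E3) univ k := by
    rw [ApproximatesLinearOn.approximatesLinearOn_iff_lipschitzOnWith]
    have : ((fun x => x + φ x) -
        ⇑((ContinuousLinearEquiv.refl ℝ E3 : E3 ≃L[ℝ] E3) : E3 →L[ℝ] E3)) = φ := by
      ext x; simp
    rw [this]
    exact hφ.lipschitzOnWith
  have hN : k < ‖((ContinuousLinearEquiv.refl ℝ E3).symm : E3 →L[ℝ] E3)‖₊⁻¹ := by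
    have : ‖((ContinuousLinearEquiv.refl ℝ E3).symm : E3 →L[ℝ] E3)‖₊ = 1 := by
      ext
      simp
    rw [this]; simpa using hk
  exact (happ.toHomeomorph _ (Or.inr hN)).isHomeomorph

/-- A displacement of a curve that is Lipschitz with a small constant extends to an ambient
isotopy. -/
theorem exists_small_displacement_constant : ∃ q > 0, ∀ (L : ℝ) (K K' : ℝ → E3),
    (∀ s ∈ Icc 0 L, ∀ s' ∈ Icc 0 L,
      ‖(K' s - K s) - (K' s' - K s')‖ ≤ q * ‖K s - K s'‖) → AmbientIsotopic L K K' := by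
  have hκ : 0 < lipschitzExtensionConstant E3 := lipschitzExtensionConstant_pos E3
  set κ := lipschitzExtensionConstant E3
  -- Extension to the whole space multiplies the Lipschitz constant by `κ`, which leaves `1 / 2 <
  -- 1`.
  refine ⟨((κ⁻¹ / 2 : NNReal) : ℝ), by positivity, fun L K K' h => ?_⟩
  classical
  let σ' : E3 → ℝ := fun x => if hx : ∃ s ∈ Icc 0 L, K s = x then hx.choose else 0
  have hσ' : ∀ s ∈ Icc 0 L, σ' (K s) ∈ Icc 0 L ∧ K (σ' (K s)) = K s := by
    intro s hs
    have hx : ∃ s' ∈ Icc 0 L, K s' = K s := ⟨s, hs, rfl⟩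
    simp only [σ', dif_pos hx]
    exact hx.choose_spec
  let D : E3 → E3 := fun x => K' (σ' x) - K (σ' x)
  have hD : LipschitzOnWith (κ⁻¹ / 2) D (K '' Icc 0 L) := by
    refine LipschitzOnWith.of_dist_le_mul ?_
    rintro _ ⟨s, hs, rfl⟩ _ ⟨s', hs', rfl⟩
    have := h _ (hσ' s hs).1 _ (hσ' s' hs').1
    rw [dist_eq_norm, dist_eq_norm]
    simp only [D, (hσ' s hs).2, (hσ' s' hs').2] at this ⊢
    exact this
  -- Where `K` takes a value twice, the hypothesis forces equal displacements, so the choice of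
  -- parameter is immaterial and injectivity of `K` is not needed.
  have hDK : ∀ s ∈ Icc 0 L, D (K s) = K' s - K s := by
    intro s hs
    have := h _ (hσ' s hs).1 s hs
    rw [(hσ' s hs).2, sub_self, norm_zero, mul_zero] at this
    have := norm_le_zero_iff.1 this
    rw [sub_eq_zero] at this
    simp only [D]
    rw [(hσ' s hs).2]
    exact this
  obtain ⟨φ, hφ, hφeq⟩ := hD.extend_finite_dimension
  have hφc : Continuous φ := hφ.continuous
  refine ⟨fun p => p.1 + (p.2 : ℝ) • φ p.1, by fun_prop, fun t => ?_, fun x => by simp,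
    fun s hs => ?_⟩
  · refine isHomeomorph_id_add (k := κ * (κ⁻¹ / 2)) ?_ ?_
    · rw [← mul_div_assoc, mul_inv_cancel₀ hκ.ne']
      exact NNReal.half_lt_self one_ne_zero
    · refine LipschitzWith.of_dist_le_mul fun x y => ?_
      rw [dist_smul₀, Real.norm_of_nonneg t.2.1]
      exact (mul_le_of_le_one_left dist_nonneg t.2.2).trans (hφ.dist_le_mul x y)
  · simp only [Set.Icc.coe_one, one_smul]
    rw [← hφeq (mem_image_of_mem K hs), hDK s hs]
    abel

/-- A straight-line homotopy whose curves are uniformly bi-Lipschitz is realized by an ambient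
isotopy. -/
theorem ambientIsotopic_of_straight_line {L M : ℝ} {K D : ℝ → E3}
    (h : ∀ u ∈ Icc (0 : ℝ) 1, ∀ s ∈ Icc 0 L, ∀ s' ∈ Icc 0 L,
      ‖D s - D s'‖ ≤ M * ‖(K s + u • D s) - (K s' + u • D s')‖) :
    AmbientIsotopic L K fun s => K s + D s := by
  obtain ⟨q, hq, hsmall⟩ := exists_small_displacement_constant
  -- The homotopy is cut into `N` steps, each with Lipschitz constant `M / N ≤ q` relative to its
  -- starting curve.
  obtain ⟨N, hN⟩ := exists_nat_gt (max (M / q) 0)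
  have hN0 : (0 : ℝ) < N := (le_max_right _ _).trans_lt hN
  have hMN : M / N ≤ q := by
    rw [div_le_iff₀ hN0, ← div_le_iff₀' hq]
    exact ((le_max_left _ _).trans_lt hN).le
  have key : ∀ n : ℕ, n ≤ N → AmbientIsotopic L K fun s => K s + ((n : ℝ) / N) • D s := by
    intro n
    induction n with
    | zero => intro _; simpa using AmbientIsotopic.refl L K
    | succ n ih =>
      intro hn
      refine (ih (Nat.le_of_succ_le hn)).trans (hsmall L _ _ fun s hs s' hs' => ?_)
      have hu : (n : ℝ) / N ∈ Icc (0 : ℝ) 1 :=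
        ⟨by positivity, (div_le_one hN0).2 (by exact_mod_cast Nat.le_of_succ_le hn)⟩
      have e : ∀ x : ℝ, (K x + (((n + 1 : ℕ) : ℝ) / N) • D x) - (K x + ((n : ℝ) / N) • D x) =
          (1 / (N : ℝ)) • D x := fun x => by
        rw [add_sub_add_left_eq_sub, ← sub_smul]
        congr 1
        push_cast
        ring
      rw [e, e, ← smul_sub, norm_smul, Real.norm_of_nonneg (by positivity)]
      calc 1 / (N : ℝ) * ‖D s - D s'‖ ≤ 1 / (N : ℝ) * (M * _) :=
            mul_le_mul_of_nonneg_left (h _ hu s hs s' hs') (by positivity)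
        _ = M / N * _ := by ring
        _ ≤ q * _ := mul_le_mul_of_nonneg_right hMN (norm_nonneg _)
  have := key N le_rfl
  rw [div_self hN0.ne'] at this
  simpa using this

/-! ### Bi-Lipschitz bounds for nearby embedded curves -/

namespace IsTubeCurve

variable {L r m V : ℝ} {c T : ℝ → E3}

theorem norm_sub_le (h : IsTubeCurve L r m V c T) (hr : 0 ≤ r) {a b : ℝ} (hab : a ≤ b) :
    ‖c b - c a‖ ≤ V * (b - a) := by
  have hcont := h.continuous
  choose v w hc hT hw hV hm using h.exists_deriv
  refine norm_image_sub_le_of_norm_deriv_right_le_segment (f' := fun x => v x • T x)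
    hcont.continuousOn (fun x _ => hc x) (fun x _ => ?_) b (right_mem_Icc.2 hab)
  have hv : 0 ≤ v x := by nlinarith [hm x, mul_nonneg hr (norm_nonneg (w x)), h.margin_pos]
  rw [norm_smul, h.norm_tangent, mul_one, Real.norm_of_nonneg hv]
  exact hV x

/-- The root terms cancel when the monotonicity statements for `q = 1` and `q = -1` are added. -/
theorem mul_le_inner_sub (h : IsTubeCurve L r m V c T) (hr : 0 ≤ r) {a b f₀ : ℝ} (hab : a ≤ b)
    (hf₀ : 0 ≤ f₀) {e : E3} (he : ‖e‖ = 1) (hf : ∀ u ∈ Ico a b, f₀ ≤ inner ℝ (T u) e) :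
    m * f₀ * (b - a) ≤ inner ℝ (c b - c a) e := by
  have h1 := h.inner_add_mul_sqrt_le hr he (ε := 1) (q := 1) hab hf₀ one_pos (by simp) hf
  have h2 := h.inner_add_mul_sqrt_le hr he (ε := 1) (q := -1) hab hf₀ one_pos (by simp) hf
  rw [inner_sub_left]
  linarith

theorem periodic_add_int (h : IsTubeCurve L r m V c T) (n : ℤ) (s : ℝ) : c (s + n * L) = c s := by
  simpa using h.periodic.int_mul n s

/-- Two curves that are close together with their tangents, the first of which is embedded, are
joined by a straight-line homotopy of uniformly bi-Lipschitz curves. -/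
theorem exists_straight_line_bound {m' V' : ℝ} {c' T' : ℝ → E3} (hL : 0 < L) (hr : 0 ≤ r)
    (h : IsTubeCurve L r m V c T) (h' : IsTubeCurve L r m' V' c' T') {a μ : ℝ} (hμ : 0 < μ)
    (hT : ∀ s u, |u - s| ≤ a → 1 / 2 ≤ inner ℝ (T u) (T s) ∧ 1 / 2 ≤ inner ℝ (T' u) (T s))
    (hfar : ∀ s s', a ≤ |s - s'| → |s - s'| ≤ L / 2 → μ ≤ ‖c s - c s'‖)
    (hnear : ∀ s, ‖c' s - c s‖ ≤ μ / 4) :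
    ∃ M, ∀ u ∈ Icc (0 : ℝ) 1, ∀ s s', ‖(c' s - c s) - (c' s' - c s')‖ ≤
      M * ‖(c s + u • (c' s - c s)) - (c s' + u • (c' s' - c s'))‖ := by
  have hV := h.speed_bound_pos hr
  have hV' := h'.speed_bound_pos hr
  have hm := h.margin_pos
  have hm' := h'.margin_pos
  set k := min m m' / 2 with hk
  have hk0 : 0 < k := by positivity
  -- The displacement is Lipschitz in the parameter with constant `V + V'`. The parameter distance
  -- is at most `‖X‖ / k` on short arcs, where both curves advance along `T s`, and at most `(L / μ)
  -- ‖X‖` on long ones, where `‖X‖ ≥ μ / 2`.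
  refine ⟨(V + V') * (1 / k + L / μ), fun u hu => ?_⟩
  have main : ∀ s s', s ≤ s' → s' - s ≤ L / 2 → ‖(c' s' - c s') - (c' s - c s)‖ ≤
      (V + V') * (1 / k + L / μ) * ‖(c s' + u • (c' s' - c s')) - (c s + u • (c' s - c s))‖ := by
    intro s s' hs hs'
    have hup : ‖(c' s' - c s') - (c' s - c s)‖ ≤ (V + V') * (s' - s) := by
      have e : (c' s' - c s') - (c' s - c s) = (c' s' - c' s) - (c s' - c s) := by abel
      rw [e]
      linarith [_root_.norm_sub_le (c' s' - c' s) (c s' - c s),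
        h.norm_sub_le hr hs, h'.norm_sub_le hr hs]
    set X := (c s' + u • (c' s' - c s')) - (c s + u • (c' s - c s)) with hX
    have hlow : s' - s ≤ (1 / k + L / μ) * ‖X‖ := by
      rcases le_total (s' - s) a with hle | hge
      · have hin : ∀ x ∈ Ico s s', |x - s| ≤ a := fun x hx => by
          rw [abs_of_nonneg (sub_nonneg.2 hx.1)]; linarith [hx.2]
        have i1 := h.mul_le_inner_sub hr hs (by norm_num) (h.norm_tangent s)
          fun x hx => (hT s x (hin x hx)).1
        have i2 := h'.mul_le_inner_sub hr hs (by norm_num) (h.norm_tangent s)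
          fun x hx => (hT s x (hin x hx)).2
        have e : X = (1 - u) • (c s' - c s) + u • (c' s' - c' s) := by
          rw [hX]; module
        have i3 : k * (s' - s) ≤ inner ℝ X (T s) := by
          rw [e, inner_add_left, inner_smul_left, inner_smul_left]
          simp only [conj_trivial]
          have hss : 0 ≤ s' - s := sub_nonneg.2 hs
          have k1 : k * (s' - s) ≤ m * (1 / 2) * (s' - s) :=
            mul_le_mul_of_nonneg_right (by rw [hk]; linarith [min_le_left m m']) hss
          have k2 : k * (s' - s) ≤ m' * (1 / 2) * (s' - s) :=
            mul_le_mul_of_nonneg_right (by rw [hk]; linarith [min_le_right m m']) hss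
          have j1 := mul_le_mul_of_nonneg_left (k1.trans i1) (sub_nonneg.2 hu.2)
          have j2 := mul_le_mul_of_nonneg_left (k2.trans i2) hu.1
          linarith
        have i4 := real_inner_le_norm X (T s)
        rw [h.norm_tangent, mul_one] at i4
        have i5 : s' - s ≤ 1 / k * ‖X‖ := by
          rw [one_div, inv_mul_eq_div, le_div_iff₀ hk0]; linarith
        have : 0 ≤ L / μ * ‖X‖ := by positivity
        linarith
      · have habs : |s' - s| = s' - s := abs_of_nonneg (sub_nonneg.2 hs)
        have i1 := hfar s' s (by rw [habs]; exact hge) (by rw [habs]; exact hs')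
        have hun : ∀ x, ‖u • (c' x - c x)‖ ≤ μ / 4 := fun x => by
          rw [norm_smul, Real.norm_of_nonneg hu.1]
          exact (mul_le_of_le_one_left (norm_nonneg _) hu.2).trans (hnear x)
        have e : c s' - c s = X - u • (c' s' - c s') + u • (c' s - c s) := by
          rw [hX]; abel
        have i2 : ‖c s' - c s‖ ≤ ‖X‖ + μ / 4 + μ / 4 := by
          rw [e]
          exact (norm_add_le _ _).trans (add_le_add ((_root_.norm_sub_le _ _).trans
            (add_le_add le_rfl (hun _))) (hun _))
        have i3 : μ / 2 ≤ ‖X‖ := by linarith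
        have i4 : L / 2 ≤ L / μ * ‖X‖ := by
          rw [div_mul_eq_mul_div, le_div_iff₀ hμ]
          nlinarith
        have : 0 ≤ 1 / k * ‖X‖ := by positivity
        linarith
    calc _ ≤ (V + V') * (s' - s) := hup
      _ ≤ (V + V') * ((1 / k + L / μ) * ‖X‖) := mul_le_mul_of_nonneg_left hlow (by positivity)
      _ = _ := by ring
  have main' : ∀ s s', |s - s'| ≤ L / 2 → ‖(c' s - c s) - (c' s' - c s')‖ ≤
      (V + V') * (1 / k + L / μ) * ‖(c s + u • (c' s - c s)) - (c s' + u • (c' s' - c s'))‖ := by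
    intro s s' hss
    rcases le_total s s' with hle | hle
    · rw [norm_sub_rev, norm_sub_rev (c s + _)]
      exact main s s' hle (by rw [abs_sub_comm] at hss; exact (le_abs_self _).trans hss)
    · exact main s' s hle ((le_abs_self _).trans hss)
  intro s s'
  -- By periodicity `s'` may be replaced by its translate nearest to `s`.
  have := main' s (s' + round ((s - s') / L) * L) (by
    have h1 := abs_sub_round ((s - s') / L)
    have h2 : s - (s' + round ((s - s') / L) * L) = ((s - s') / L - round ((s - s') / L)) * L := by
      field_simp; ring
    rw [h2, abs_mul, abs_of_pos hL]
    nlinarith)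
  rwa [h.periodic_add_int, h'.periodic_add_int] at this

end IsTubeCurve

section Family

variable {L r : ℝ} [Fact (0 < L)] {C T : I → AddCircle L → E3} {m V : I → ℝ}

/-- Injectivity and compactness separate points of `C t₀` with distant parameters; continuity of the
tangents controls close parameters. Both directions are stated since the clopen argument in time
needs one for openness and the other for closedness. -/
theorem eventually_ambientIsotopic (hr : 0 < r)
    (h : ∀ t, IsTubeCurve L r (m t) (V t) (fun x : ℝ => C t x) (fun x : ℝ => T t x))
    (F : IsTubeFamily L r C T) {t₀ : I} (hinj : Function.Injective (C t₀)) :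
    ∀ᶠ t in 𝓝 t₀, AmbientIsotopic L (fun x => C t₀ x) (fun x => C t x) ∧
      AmbientIsotopic L (fun x => C t x) (fun x => C t₀ x) := by
  have hL : 0 < L := Fact.out
  have hC₀ : Continuous (C t₀) := F.continuous.comp (Continuous.prodMk_right t₀)
  have hT₀ : Continuous (T t₀) := F.continuous_tangent.comp (Continuous.prodMk_right t₀)
  obtain ⟨a, ha, hTa⟩ := Metric.uniformContinuous_iff.1
    (CompactSpace.uniformContinuous_of_continuous hT₀) (1 / 4) (by norm_num)
  obtain ⟨μ, hμ, hfar⟩ : ∃ μ : ℝ, 0 < μ ∧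
      ∀ p ∈ {p : AddCircle L × AddCircle L | a / 2 ≤ dist p.1 p.2}, μ ≤ ‖C t₀ p.1 - C t₀ p.2‖ := by
    refine IsCompact.exists_forall_le' (IsClosed.isCompact
      (isClosed_le continuous_const (by fun_prop))) (by fun_prop) fun p hp => ?_
    rw [norm_pos_iff, sub_ne_zero]
    intro e
    have := hinj e
    have hp' : a / 2 ≤ dist p.1 p.2 := hp
    rw [this, dist_self] at hp'
    linarith
  have hclose : ∀ {X : I → AddCircle L → E3}, (Continuous fun p : I × AddCircle L => X p.1 p.2) →
      ∀ ε > 0, ∀ᶠ t in 𝓝 t₀, ∀ s, dist (X t s) (X t₀ s) < ε := by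
    intro X hX ε hε
    have := isCompact_univ.eventually_forall_of_forall_eventually (x₀ := t₀)
      (K := (univ : Set (AddCircle L))) (P := fun t s => dist (X t s) (X t₀ s) < ε) fun s _ => by
        have hX₀ : Continuous fun p : I × AddCircle L => X t₀ p.2 :=
          hX.comp (continuous_const.prodMk continuous_snd)
        refine (hX.dist hX₀).continuousAt.eventually_lt_const ?_
        simpa using hε
    filter_upwards [this] with t ht s using ht s (mem_univ s)
  filter_upwards [hclose F.continuous (μ / 4) (by positivity),
    hclose F.continuous_tangent (1 / 4) (by norm_num)] with t htC htT
  obtain ⟨M, hM⟩ := (h t₀).exists_straight_line_bound hL hr.le (h t) (a := a / 2) hμ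
    (fun s u hsu => by
      have hd : dist (s : AddCircle L) (u : AddCircle L) < a := by
        rw [dist_comm, dist_eq_norm, ← AddCircle.coe_sub]
        exact QuotientAddGroup.norm_mk_le_norm.trans_lt (by rw [Real.norm_eq_abs]; linarith)
      exact ⟨inner_gt_half (F.norm_tangent _ _) (F.norm_tangent _ _) (w := T t₀ u)
          (by rw [dist_self]; norm_num) (hTa hd),
        inner_gt_half (F.norm_tangent _ _) (F.norm_tangent _ _) (w := T t₀ u) (htT _) (hTa hd)⟩)
    (fun s s' h1 h2 => hfar ((s : AddCircle L), (s' : AddCircle L)) (by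
      have : dist (s : AddCircle L) (s' : AddCircle L) = |s - s'| := by
        rw [dist_eq_norm, ← AddCircle.coe_sub, AddCircle.norm_coe_eq_abs_iff _ hL.ne',
          abs_of_pos hL]
        exact h2
      rw [mem_ofPred_eq, this]
      exact h1))
    (fun s => by rw [← dist_eq_norm]; exact (htC _).le)
  constructor
  · have := ambientIsotopic_of_straight_line (L := L) (M := M) (K := fun x : ℝ => C t₀ x)
      (D := fun x : ℝ => C t x - C t₀ x) fun u hu s _ s' _ => hM u hu s s'
    simpa using this
  · have := ambientIsotopic_of_straight_line (L := L) (M := M) (K := fun x : ℝ => C t x)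
      (D := fun x : ℝ => C t₀ x - C t x) fun u hu s _ s' _ => by
        -- The same segment of curves, run backwards.
        have := hM (1 - u) ⟨by linarith [hu.2], by linarith [hu.1]⟩ s s'
        have e : ∀ x : ℝ, C t₀ x + (1 - u) • (C t x - C t₀ x) = C t x + u • (C t₀ x - C t x) :=
          fun x => by module
        rw [norm_sub_rev, show C t₀ (s' : AddCircle L) - C t s' - (C t₀ (s : AddCircle L) - C t s) =
          C t s - C t₀ s - (C t s' - C t₀ s') by abel]
        simpa only [e] using this
    simpa using this

/-- If all curves of the family are embedded, the first and the last are ambient isotopic. -/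
theorem ambientIsotopic_of_injective (hr : 0 < r)
    (h : ∀ t, IsTubeCurve L r (m t) (V t) (fun x : ℝ => C t x) (fun x : ℝ => T t x))
    (F : IsTubeFamily L r C T) (hinj : ∀ t, Function.Injective (C t)) (t₁ : I) :
    AmbientIsotopic L (fun x => C 0 x) (fun x => C t₁ x) := by
  have hclopen : IsClopen {t : I | AmbientIsotopic L (fun x => C 0 x) (fun x => C t x)} := by
    constructor
    · refine isClosed_of_closure_subset fun t ht => ?_
      obtain ⟨t', h1, h2⟩ := ((mem_closure_iff_frequently.1 ht).and_eventually
        (eventually_ambientIsotopic hr h F (hinj t))).exists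
      exact AmbientIsotopic.trans h1 h2.2
    · refine isOpen_iff_mem_nhds.2 fun t ht => ?_
      filter_upwards [eventually_ambientIsotopic hr h F (hinj t)] with t' ht'
      exact AmbientIsotopic.trans ht ht'.1
  exact (hclopen.eq_univ ⟨0, AmbientIsotopic.refl _ _⟩).superset (mem_univ t₁)

end Family

/-! ### The frame of a closed curve -/

namespace IsClosedCurve

variable {L r : ℝ} {c : ℝ → E3}

theorem speed_pos (h : IsClosedCurve L c) {s : ℝ} (hs : s ∈ Icc 0 L) :
    0 < ‖derivWithin c (Icc 0 L) s‖ := norm_pos_iff.2 (h.regular s hs)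

theorem norm_tangent (h : IsClosedCurve L c) {s : ℝ} (hs : s ∈ Icc 0 L) : ‖tangent L c s‖ = 1 :=
  norm_smul_inv_norm (h.regular s hs)

theorem contDiffOn_derivWithin (h : IsClosedCurve L c) (hL : 0 < L) :
    ContDiffOn ℝ 2 (derivWithin c (Icc 0 L)) (Icc 0 L) :=
  h.contDiffOn.derivWithin (uniqueDiffOn_Icc hL) (by norm_num)

theorem contDiffOn_tangent (h : IsClosedCurve L c) (hL : 0 < L) :
    ContDiffOn ℝ 2 (tangent L c) (Icc 0 L) := by
  have h1 := h.contDiffOn_derivWithin hL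
  exact ((h1.norm ℝ h.regular).inv fun s hs => (h.speed_pos hs).ne').smul h1

theorem hasDerivWithinAt_tangent (h : IsClosedCurve L c) (hL : 0 < L) {s : ℝ} (hs : s ∈ Icc 0 L) :
    HasDerivWithinAt (tangent L c) (derivWithin (tangent L c) (Icc 0 L) s) (Icc 0 L) s :=
  (((h.contDiffOn_tangent hL).differentiableOn (by norm_num)) s hs).hasDerivWithinAt

theorem inner_deriv_tangent (h : IsClosedCurve L c) (hL : 0 < L) {s : ℝ} (hs : s ∈ Icc 0 L) :
    inner ℝ (derivWithin (tangent L c) (Icc 0 L) s) (tangent L c s) = 0 := by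
  have h1 := h.hasDerivWithinAt_tangent hL hs
  have h2 : HasDerivWithinAt (fun _ : ℝ => (1 : ℝ)) _ (Icc 0 L) s :=
    (h1.inner ℝ h1).congr (fun x hx => by
      rw [real_inner_self_eq_norm_sq, h.norm_tangent hx]; norm_num)
      (by rw [real_inner_self_eq_norm_sq, h.norm_tangent hs]; norm_num)
  have h3 := (uniqueDiffOn_Icc hL s hs).eq_deriv _ h2 (hasDerivWithinAt_const _ _ _)
  rw [real_inner_comm (derivWithin (tangent L c) (Icc 0 L) s) (tangent L c s)] at h3
  linarith

theorem inner_tangent_curvatureVector (h : IsClosedCurve L c) (hL : 0 < L) {s : ℝ}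
    (hs : s ∈ Icc 0 L) : inner ℝ (tangent L c s) (curvatureVector L c s) = 0 := by
  rw [curvatureVector, inner_smul_right, real_inner_comm, h.inner_deriv_tangent hL hs, mul_zero]

theorem norm_normal (c : ℝ → E3) (s : ℝ) : ‖normal L c s‖ = 1 := by
  unfold normal
  split_ifs with h0
  · exact (exists_unit_orthogonal (tangent L c s)).choose_spec.1
  · exact norm_smul_inv_norm h0

theorem inner_tangent_normal (h : IsClosedCurve L c) (hL : 0 < L) {s : ℝ} (hs : s ∈ Icc 0 L) :
    inner ℝ (tangent L c s) (normal L c s) = 0 := by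
  unfold normal
  split_ifs with h0
  · exact (exists_unit_orthogonal (tangent L c s)).choose_spec.2
  · rw [inner_smul_right, h.inner_tangent_curvatureVector hL hs, mul_zero]

theorem inner_offset (h : IsClosedCurve L c) (hL : 0 < L) {x : ℝ × ℝ × ℝ}
    (hx : x ∈ coords L r) : inner ℝ (offset L c x) (tangent L c x.2.1) = 0 :=
  inner_frame_combination (h.inner_tangent_normal hL hx.2.1) _ _

theorem norm_offset (h : IsClosedCurve L c) (hL : 0 < L) {x : ℝ × ℝ × ℝ}
    (hx : x ∈ coords L r) : ‖offset L c x‖ = x.1 :=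
  norm_frame_cos_sin (h.norm_tangent hx.2.1) (norm_normal c _) (h.inner_tangent_normal hL hx.2.1)
    hx.1.1 _

theorem exists_coords (h : IsClosedCurve L c) (hL : 0 < L) {s : ℝ} (hs : s ∈ Icc 0 L) {v : E3}
    (hv : inner ℝ v (tangent L c s) = 0) (hvr : ‖v‖ ≤ r) :
    ∃ x ∈ coords L r, x.1 = ‖v‖ ∧ x.2.1 = s ∧ offset L c x = v := by
  obtain ⟨θ, hθ, hvθ⟩ := exists_polar (h.norm_tangent hs) (norm_normal c _)
    (h.inner_tangent_normal hL hs) hv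
  exact ⟨(‖v‖, s, θ), ⟨⟨norm_nonneg v, hvr⟩, hs, hθ⟩, rfl, rfl, hvθ.symm⟩

end IsClosedCurve

/-! ### Passage from the interval to the circle -/

section Periodize

variable {L r : ℝ} [hL : Fact (0 < L)]

theorem liftIco_coe_of_mem_Icc {X : Type*} {f : ℝ → X} (hf : f 0 = f L) {s : ℝ}
    (hs : s ∈ Icc 0 L) : AddCircle.liftIco L 0 f s = f s := by
  rcases hs.2.eq_or_lt with rfl | hlt
  · rw [AddCircle.coe_period, ← hf]
    exact AddCircle.liftIco_zero_coe_apply (x := 0) ⟨le_rfl, hL.out⟩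
  · exact AddCircle.liftIco_zero_coe_apply ⟨hs.1, hlt⟩

theorem exists_mem_Ico_coe_eq (s : AddCircle L) : ∃ x ∈ Ico 0 L, (x : AddCircle L) = s := by
  have : s ∈ ((↑) : ℝ → AddCircle L) '' Ico 0 (0 + L) := by
    rw [AddCircle.coe_image_Ico_eq]; exact mem_univ s
  rwa [zero_add] at this

theorem coe_eq_coe_iff_of_mem_Icc {s s' : ℝ} (hs : s ∈ Icc 0 L) (hs' : s' ∈ Icc 0 L) :
    (s : AddCircle L) = s' ↔ s = s' ∨ (s = 0 ∧ s' = L) ∨ (s = L ∧ s' = 0) := by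
  have hI : ∀ {x y : ℝ}, x ∈ Ico 0 L → y ∈ Ico 0 L → ((x : AddCircle L) = y ↔ x = y) :=
    fun hx hy => AddCircle.coe_eq_coe_iff_of_mem_Ico (a := 0) (by simpa using hx)
      (by simpa using hy)
  have h0 : (0 : ℝ) ∈ Ico 0 L := ⟨le_rfl, hL.out⟩
  have hLc : ((L : ℝ) : AddCircle L) = (0 : ℝ) := by simp
  constructor
  · intro h
    rcases hs.2.eq_or_lt with rfl | h1
    · rcases hs'.2.eq_or_lt with rfl | h2
      · exact Or.inl rfl
      · rw [hLc, hI h0 ⟨hs'.1, h2⟩] at h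
        exact Or.inr (Or.inr ⟨rfl, h.symm⟩)
    · rcases hs'.2.eq_or_lt with rfl | h2
      · rw [hLc, hI ⟨hs.1, h1⟩ h0] at h
        exact Or.inr (Or.inl ⟨h, rfl⟩)
      · exact Or.inl ((hI ⟨hs.1, h1⟩ ⟨hs'.1, h2⟩).1 h)
  · rintro (rfl | ⟨rfl, rfl⟩ | ⟨rfl, rfl⟩)
    · rfl
    · exact hLc.symm
    · exact hLc

/-- To the right of a point of `[0, L)` the periodization agrees with `f`; translation by `x - s`, a
period, reaches every other lift. No matching of derivatives at the seam is required. -/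
theorem hasDerivWithinAt_liftIco {f : ℝ → E3} {s : ℝ} (hs : s ∈ Ico 0 L) {d : E3}
    (hf : HasDerivWithinAt f d (Icc 0 L) s) (x : ℝ) (hx : (x : AddCircle L) = s) :
    HasDerivWithinAt (fun y : ℝ => AddCircle.liftIco L 0 f y) d (Ici x) x := by
  have h1 : HasDerivWithinAt (fun y : ℝ => AddCircle.liftIco L 0 f y) d (Ici s) s := by
    have h2 : HasDerivWithinAt f d (Ico s L) s :=
      hf.mono fun y hy => ⟨hs.1.trans hy.1, hy.2.le⟩
    have h3 : HasDerivWithinAt (fun y : ℝ => AddCircle.liftIco L 0 f y) d (Ico s L) s :=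
      h2.congr (fun y hy => AddCircle.liftIco_zero_coe_apply ⟨hs.1.trans hy.1, hy.2⟩)
        (AddCircle.liftIco_zero_coe_apply hs)
    exact h3.mono_of_mem_nhdsWithin (Ico_mem_nhdsGE hs.2)
  have hsub : ((x - s : ℝ) : AddCircle L) = 0 := by rw [AddCircle.coe_sub, hx, sub_self]
  have hs' : x - (x - s) = s := by ring
  have h4 : HasDerivWithinAt (fun y : ℝ => AddCircle.liftIco L 0 f y) d (Ici (x - (x - s)))
      (x - (x - s)) := by rwa [hs']
  have h5 := h4.scomp x ((hasDerivWithinAt_id x (Ici x)).sub_const (x - s))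
    fun y hy => by
      have : x ≤ y := hy
      show x - (x - s) ≤ y - (x - s)
      linarith
  rw [one_smul] at h5
  have h6 : ∀ y : ℝ, ((y - (x - s) : ℝ) : AddCircle L) = y := fun y => by
    rw [AddCircle.coe_sub, hsub, sub_zero]
  exact h5.congr (fun y _ => by simp only [Function.comp, id, h6])
    (by simp only [Function.comp, id, h6])

theorem IsClosedCurve.isTubeCurve {c : ℝ → E3} (h : IsClosedCurve L c)
    (hκ : ∀ s ∈ Icc 0 L, r * curvature L c s < 1) : ∃ m V, IsTubeCurve L r m V
      (fun x : ℝ => AddCircle.liftIco L 0 c x)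
      (fun x : ℝ => AddCircle.liftIco L 0 (tangent L c) x) := by
  have hL0 : 0 < L := hL.out
  have hcd := h.contDiffOn_derivWithin hL0
  have hT := h.contDiffOn_tangent hL0
  have hTd : ContinuousOn (derivWithin (tangent L c) (Icc 0 L)) (Icc 0 L) :=
    hT.continuousOn_derivWithin (uniqueDiffOn_Icc hL0) (by norm_num)
  -- Multiplied by the speed, `r κ < 1` says that `‖c'‖ - r ‖T'‖` is positive; compactness gives the
  -- uniform margin.
  obtain ⟨m, hm, hmle⟩ := isCompact_Icc.exists_forall_le' (a := 0)
    (hcd.continuousOn.norm.sub (hTd.norm.const_smul r)) fun s hs => by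
      have h1 := hκ s hs
      have h2 := h.speed_pos hs
      rw [curvature, curvatureVector, norm_smul, norm_inv, norm_norm] at h1
      have h3 : r * (‖derivWithin c (Icc 0 L) s‖⁻¹ * ‖derivWithin (tangent L c) (Icc 0 L) s‖) =
          r * ‖derivWithin (tangent L c) (Icc 0 L) s‖ / ‖derivWithin c (Icc 0 L) s‖ := by ring
      rw [h3, div_lt_one h2] at h1
      simpa using h1
  obtain ⟨V, hV⟩ := isCompact_Icc.exists_bound_of_continuousOn hcd.continuousOn
  refine ⟨m, V, ?_, ?_, ?_, ?_, ?_, hm, ?_⟩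
  · exact (AddCircle.liftIco_zero_continuous h.closed h.contDiffOn.continuousOn).comp
      (AddCircle.continuous_mk' L)
  · exact (AddCircle.liftIco_zero_continuous h.tangent_closed hT.continuousOn).comp
      (AddCircle.continuous_mk' L)
  · intro x; simp
  · intro x; simp
  · intro x
    obtain ⟨s, hs, hsx⟩ := exists_mem_Ico_coe_eq (x : AddCircle L)
    rw [← hsx, AddCircle.liftIco_zero_coe_apply hs]
    exact h.norm_tangent ⟨hs.1, hs.2.le⟩
  · intro x
    obtain ⟨s, hs, hsx⟩ := exists_mem_Ico_coe_eq (x : AddCircle L)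
    have hs' : s ∈ Icc 0 L := ⟨hs.1, hs.2.le⟩
    refine ⟨‖derivWithin c (Icc 0 L) s‖, derivWithin (tangent L c) (Icc 0 L) s, ?_,
      hasDerivWithinAt_liftIco hs (h.hasDerivWithinAt_tangent hL0 hs') x hsx.symm, ?_, hV s hs',
      hmle s hs'⟩
    · rw [← hsx, AddCircle.liftIco_zero_coe_apply hs, tangent, smul_smul,
        mul_inv_cancel₀ (h.speed_pos hs').ne', one_smul]
      exact hasDerivWithinAt_liftIco hs
        ((h.contDiffOn.differentiableOn (by norm_num)) s hs').hasDerivWithinAt x hsx.symm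
    · rw [← hsx, AddCircle.liftIco_zero_coe_apply hs]
      exact h.inner_deriv_tangent hL0 hs'

/-- Points of the tube in coordinates, as points of the solid torus. -/
theorem IsClosedCurve.exists_solidTorus_pair {c : ℝ → E3} (h : IsClosedCurve L c)
    {x y : ℝ × ℝ × ℝ} (hx : x ∈ coords L r) (hy : y ∈ coords L r) (hxy : ¬ SamePoint L c x y)
    (heq : tubeMap L c x = tubeMap L c y) :
    ∃ X ∈ solidTorus r (AddCircle.liftIco L 0 (tangent L c)),
      ∃ Y ∈ solidTorus r (AddCircle.liftIco L 0 (tangent L c)),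
        AddCircle.liftIco L 0 c X.1 + X.2 = AddCircle.liftIco L 0 c Y.1 + Y.2 ∧ X.1 ≠ Y.1 ∧
          ‖X.2‖ = x.1 ∧ ‖Y.2‖ = y.1 := by
  have hL0 : 0 < L := hL.out
  have key : ∀ x ∈ coords L r, ((x.2.1 : AddCircle L), offset L c x) ∈
      solidTorus r (AddCircle.liftIco L 0 (tangent L c)) ∧
      AddCircle.liftIco L 0 c x.2.1 + offset L c x = tubeMap L c x := by
    intro x hx
    refine ⟨⟨?_, (h.norm_offset hL0 hx).trans_le hx.1.2⟩, ?_⟩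
    · simp only [liftIco_coe_of_mem_Icc h.tangent_closed hx.2.1]
      exact h.inner_offset hL0 hx
    · rw [liftIco_coe_of_mem_Icc h.closed hx.2.1, tubeMap]
  refine ⟨_, (key x hx).1, _, (key y hy).1, ((key x hx).2.trans heq).trans (key y hy).2.symm, ?_,
    h.norm_offset hL0 hx, h.norm_offset hL0 hy⟩
  intro e
  refine hxy ⟨(coe_eq_coe_iff_of_mem_Icc hx.2.1 hy.2.1).1 e, ?_⟩
  have h1 := ((key x hx).2.trans heq).trans (key y hy).2.symm
  simp only at e
  rw [e] at h1
  exact add_left_cancel h1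

/-- Points of the solid torus in distinct cross-sections, in coordinates. -/
theorem IsClosedCurve.exists_coords_pair {c : ℝ → E3} (h : IsClosedCurve L c)
    {X Y : AddCircle L × E3} (hX : X ∈ solidTorus r (AddCircle.liftIco L 0 (tangent L c)))
    (hY : Y ∈ solidTorus r (AddCircle.liftIco L 0 (tangent L c)))
    (heq : AddCircle.liftIco L 0 c X.1 + X.2 = AddCircle.liftIco L 0 c Y.1 + Y.2)
    (hne : X.1 ≠ Y.1) : ∃ x ∈ coords L r, ∃ y ∈ coords L r,
      ¬ SamePoint L c x y ∧ tubeMap L c x = tubeMap L c y ∧ x.1 = ‖X.2‖ ∧ y.1 = ‖Y.2‖ := by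
  have key : ∀ X ∈ solidTorus r (AddCircle.liftIco L 0 (tangent L c)), ∃ x ∈ coords L r,
      (x.2.1 : AddCircle L) = X.1 ∧ x.1 = ‖X.2‖ ∧
      tubeMap L c x = AddCircle.liftIco L 0 c X.1 + X.2 := by
    rintro ⟨s, v⟩ ⟨h1, h2⟩
    obtain ⟨s, hs, rfl⟩ := exists_mem_Ico_coe_eq s
    simp only [AddCircle.liftIco_zero_coe_apply hs] at h1 h2 ⊢
    obtain ⟨x, hx, hx1, hx2, hx3⟩ := h.exists_coords hL.out ⟨hs.1, hs.2.le⟩ h1 h2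
    exact ⟨x, hx, by rw [hx2], hx1, by rw [tubeMap, hx2, hx3]⟩
  obtain ⟨x, hx, hxs, hx1, hxt⟩ := key X hX
  obtain ⟨y, hy, hys, hy1, hyt⟩ := key Y hY
  refine ⟨x, hx, y, hy, fun hsame => hne ?_, by rw [hxt, hyt, heq], hx1, hy1⟩
  rw [← hxs, ← hys]
  exact (coe_eq_coe_iff_of_mem_Icc hx.2.1 hy.2.1).2 hsame.1

theorem injective_liftIco {X : Type*} {f : ℝ → X} (hf : InjOn f (Ico 0 L)) :
    Function.Injective (AddCircle.liftIco L 0 f) := by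
  intro s s' hss
  obtain ⟨x, hx, rfl⟩ := exists_mem_Ico_coe_eq s
  obtain ⟨x', hx', rfl⟩ := exists_mem_Ico_coe_eq s'
  rw [AddCircle.liftIco_zero_coe_apply hx, AddCircle.liftIco_zero_coe_apply hx'] at hss
  rw [hf hx hx' hss]

end Periodize

theorem AmbientIsotopic.congr {L : ℝ} {K₀ K₁ K₀' K₁' : ℝ → E3} (h : AmbientIsotopic L K₀ K₁)
    (h₀ : ∀ s ∈ Icc 0 L, K₀ s = K₀' s) (h₁ : ∀ s ∈ Icc 0 L, K₁ s = K₁' s) :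
    AmbientIsotopic L K₀' K₁' := by
  obtain ⟨G, hG, hGh, hG0, hG1⟩ := h
  exact ⟨G, hG, hGh, hG0, fun s hs => by rw [← h₀ s hs, ← h₁ s hs, hG1 s hs]⟩

end TubeKnot

/-! ### The first time of contact -/

theorem mainTheorem6 (L r : ℝ) (hL : 0 < L) (hr : 0 < r)
    (γ : ℝ → E3) (hγ : TubeKnot.IsClosedCurve L γ)
    (H : E3 × unitInterval → E3) (hH : Continuous H)
    (hcurve : ∀ t : unitInterval, TubeKnot.IsClosedCurve L (TubeKnot.deform H γ t))
    (hcurvature : ∀ t : unitInterval, ∀ s ∈ Set.Icc 0 L,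
      r * TubeKnot.curvature L (TubeKnot.deform H γ t) s < 1)
    (hknot₀ : TubeKnot.IsKnot L (TubeKnot.deform H γ 0))
    (hknot₁ : TubeKnot.IsKnot L (TubeKnot.deform H γ 1))
    (hclass : ¬ TubeKnot.AmbientIsotopic L (TubeKnot.deform H γ 0) (TubeKnot.deform H γ 1))
    (hstart : ¬ TubeKnot.HasSelfContact L r (TubeKnot.deform H γ 0)) :
    ∃ tstar : unitInterval, 0 < tstar ∧ tstar < 1 ∧
      TubeKnot.HasSelfContact L r (TubeKnot.deform H γ tstar) ∧
      (∀ t : unitInterval, t < tstar → ¬ TubeKnot.HasSelfContact L r (TubeKnot.deform H γ t)) ∧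
      (∃ τ : unitInterval, tstar < τ ∧ τ < 1 ∧
        TubeKnot.HasInterpenetration L r (TubeKnot.deform H γ τ)) ∧
      (∀ t : unitInterval, t < tstar →
        ¬ TubeKnot.HasInterpenetration L r (TubeKnot.deform H γ t)) := by
  have : Fact (0 < L) := ⟨hL⟩
  let C : unitInterval → AddCircle L → E3 := fun t => AddCircle.liftIco L 0 (TubeKnot.deform H γ t)
  let T : unitInterval → AddCircle L → E3 := fun t =>
    AddCircle.liftIco L 0 (TubeKnot.tangent L (TubeKnot.deform H γ t))
  choose m V hmV using fun t => (hcurve t).isTubeCurve (hcurvature t)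
  have hC : Continuous fun p : unitInterval × AddCircle L => C p.1 p.2 := by
    have h1 : Continuous (AddCircle.liftIco L 0 γ) :=
      AddCircle.liftIco_zero_continuous hγ.closed hγ.contDiffOn.continuousOn
    exact hH.comp ((h1.comp continuous_snd).prodMk continuous_fst)
  have F : TubeKnot.IsTubeFamily L r C T := TubeKnot.isTubeFamily_of_isTubeCurve hr hmV hC
  let A : Set unitInterval := {t | ∃ x y,
    (t, x, y) ∈ TubeKnot.overlaps r C T ∧ ‖x.2‖ = r ∧ ‖y.2‖ = r}
  have hA : ∀ t, TubeKnot.HasSelfContact L r (TubeKnot.deform H γ t) ↔ t ∈ A := by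
    intro t
    constructor
    · rintro ⟨x, hx, y, hy, hne, heq, hxr, hyr⟩
      obtain ⟨X, hX, Y, hY, h1, h2, h3, h4⟩ := (hcurve t).exists_solidTorus_pair hx hy hne heq
      exact ⟨X, Y, ⟨⟨hX, hY, h1⟩, h2⟩, h3.trans hxr, h4.trans hyr⟩
    · rintro ⟨X, Y, ⟨⟨hX, hY, h1⟩, h2⟩, h3, h4⟩
      obtain ⟨x, hx, y, hy, hne, heq, hxr, hyr⟩ := (hcurve t).exists_coords_pair hX hY h1 h2
      exact ⟨x, hx, y, hy, hne, heq, hxr.trans h3, hyr.trans h4⟩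
  have hpen : ∀ t, TubeKnot.HasInterpenetration L r (TubeKnot.deform H γ t) → t ∈ A := by
    rintro t ⟨x, hx, y, hy, hne, heq, -⟩
    obtain ⟨X, hX, Y, hY, h1, h2, -⟩ := (hcurve t).exists_solidTorus_pair hx hy hne heq
    exact F.selfContact_of_overlaps hr ⟨⟨hX, hY, h1⟩, h2⟩
  obtain ⟨t₁, ht₁⟩ : ∃ t, ¬ Function.Injective (C t) := by
    by_contra! hall
    exact hclass ((TubeKnot.ambientIsotopic_of_injective hr hmV F hall 1).congr
      (fun s hs => TubeKnot.liftIco_coe_of_mem_Icc (hcurve 0).closed hs)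
      (fun s hs => TubeKnot.liftIco_coe_of_mem_Icc (hcurve 1).closed hs))
  have ht₁1 : t₁ < 1 := lt_of_le_of_ne unitInterval.le_one' fun e =>
    ht₁ (e ▸ TubeKnot.injective_liftIco hknot₁.injOn)
  obtain ⟨s, s', hss, hne⟩ : ∃ s s', C t₁ s = C t₁ s' ∧ s ≠ s' := by
    simpa [Function.Injective] using ht₁
  -- A double point of the curve is an overlap of two axis points, which have `ρ = 0 < r`.
  have hpen₁ : TubeKnot.HasInterpenetration L r (TubeKnot.deform H γ t₁) := by
    have h0 : ∀ s : AddCircle L, (s, (0 : E3)) ∈ TubeKnot.solidTorus r (T t₁) := fun s =>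
      ⟨by simp, by simpa using hr.le⟩
    obtain ⟨x, hx, y, hy, hxy, heq, hx0, -⟩ := (hcurve t₁).exists_coords_pair (h0 s) (h0 s')
      (by simpa using hss) hne
    exact ⟨x, hx, y, hy, hxy, heq, Or.inl (by rw [hx0]; simpa using hr)⟩
  have hclosed : IsClosed A := F.isClosed_selfContact
  obtain ⟨tstar, hmem, hmin⟩ := hclosed.isCompact.exists_isLeast ⟨t₁, hpen t₁ hpen₁⟩
  have hbefore : ∀ t < tstar, t ∉ A := fun t ht hmem' => absurd (hmin hmem') (not_le.2 ht)
  have hpos : 0 < tstar := lt_of_le_of_ne unitInterval.nonneg' fun e =>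
    hstart ((hA 0).2 (e ▸ hmem))
  -- If `t* = t₁`, the persistence of contact around a double point would give contact at times
  -- before `t*`; such times exist because `0 < t*`.
  have hlt : tstar < t₁ := by
    refine lt_of_le_of_ne (hmin (hpen t₁ hpen₁)) fun e => ?_
    have hev := F.eventually_selfContact hr hne hss
    rw [← e] at hev
    have : (nhdsWithin tstar (Set.Iio tstar)).NeBot := nhdsLT_neBot_of_exists_lt ⟨0, hpos⟩
    obtain ⟨t, htA, ht⟩ := ((hev.filter_mono nhdsWithin_le_nhds).and
      self_mem_nhdsWithin : ∀ᶠ t in nhdsWithin tstar (Set.Iio tstar), _ ∧ _).exists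
    exact hbefore t ht htA
  exact ⟨tstar, hpos, hlt.trans ht₁1, (hA tstar).2 hmem, fun t ht h => hbefore t ht ((hA t).1 h),
    ⟨t₁, hlt, ht₁1, hpen₁⟩, fun t ht h => hbefore t ht (hpen t h)⟩
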